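/- **Setting.** Let $N\in\mathbb N$ and let $\Pi\subset\mathbb Z_+^N$ be a finite schedule set such that (i) $d\in\Pi$, $d'\in\mathbb Z_+^N$ and $d'\le d$ imply $d'\in\Pi$; (ii) for some $c>0$, $c\,e^{(i)}\in\Pi$ for every $i$; (iii) $\Pi$ has at least two distinct maximal elements. Let $\mathcal C=(\mathcal X,\mathcal Y,C)$ be a channel with finite alphabets and row-stochastic matrix $C$, and assume that it is informative, i.e. $C$ has two distinct rows. The queues evolve by $Q(t)=(Q(t-1)-D(t))^++A(t)$, $t\ge1$, where the $A_i(t)\in\{0,1\}$ are independent Bernoulli variables, independent of everything else, with means $\lambda_i\in[0,1)$; such a $\lambda$ is called an arrival rate vector. An encoding policy $\phi\in\Phi_k$ with $k$ bits of memory and *without memory-feedback* is a measurable function with $(X(t),M_e(t))=\phi(Q(t-1),A(t-1),M_e(t-1),U_e(t-1))\in\mathcal X\times\{0,1\}^k$, together with initial values $X(0),M_e(0)$. The message $Y(t)$ is drawn from row $X(t)$ of $C$. An allocation policy $\psi\in\Psi_v$ with $v$ bits of memory is a pair of measurable functions with $D(t)=\psi_a(Y(t),M_r(t-1),U_r(t-1))\in\Pi$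 and $M_r(t)=\psi_m(Y(t-1),M_r(t-1),U_r(t-1))\in\{0,1\}^v$, together with an initial value $M_r(0)$. The $U_e(t),U_r(t)$ are independent and uniform on $(0,1)$, and $Q(0)=A(0)=0$. The policies do not depend on $\lambda$. The tuple $(Q,A,M_e,X,M_r,Y)(t)$ is a countable-state Markov chain, considered on the set of states reachable from its possible initial states. Only policy pairs under which this chain is irreducible for every arrival rate vector are admitted. The system is stable if the chain is positive recurrent, and $\tilde\Lambda(\phi,\psi)$ is the set of arrival rate vectors $\lambda$ under which it is stable. Let $\Lambda=\{\lambda\in\mathbb R_+^N:\ \exists y\in\mathrm{conv}(\Pi),\ \lambda_i<y_i\ \forall i\}$ and $$\rho^*(\phi,\psi,\mathcal C)=\sup\{\rho\ge0:\ \rho\Lambda\cap[0,1)^N\subseteq\tilde\Lambda(\phi,\psi)\},\qquad \rho^*_{k,v}(\mathcal C)=\sup_{\phi\in\Phi_k,\ \psi\in\Psi_v}\rho^*(\phi,\psi,\mathcal C),$$ with values in $[0,\infty]$, where $\sup\emptyset=0$. **Theorem.** Without memory-feedback, with an infinite-memory receiver and $\log N$ bits of encoder memory, i.e. for $k=\lceil\log_2N\rceil$,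 the capacity factor is $1$: $$\rho^*_{k,\infty}(\mathcal C)=\lim_{v\to\infty}\rho^*_{k,v}(\mathcal C)=1\qquad\text{whenever }(1,\dots,1)\notin\mathrm{conv}(\Pi).$$ If $(1,\dots,1)\in\mathrm{conv}(\Pi)$ (then $\Lambda$ contains every arrival rate vector, so that $\rho>1$ asks for no more than $\rho=1$), the same holds with the capacity factor capped at $1$. That is, in all cases $\lim_{v\to\infty}\min\{\rho^*_{k,v}(\mathcal C),1\}=1$. -/

import Mathlib

open scoped ENNReal NNReal Pointwise
open Filter Topology MeasureTheory

/-! ### Countable-state Markov chains given by a transition matrix -/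

namespace MarkovChain

variable {S : Type*}

/-- `t` can be reached from `s` in finitely many (possibly zero) steps of positive probability. -/
def Leads (P : S → S → ℝ≥0∞) : S → S → Prop :=
  Relation.ReflTransGen (fun s t => 0 < P s t)

/-- The state space of the chain: all states that can be reached from the set `I` of possible
initial states. -/
def stateSpace (P : S → S → ℝ≥0∞) (I : Set S) : Set S :=
  {s | ∃ s₀ ∈ I, Leads P s₀ s}

/-- Any two states of the chain communicate. -/
def IsIrreducible (P : S → S → ℝ≥0∞) (I : Set S) : Prop :=
  ∀ s ∈ stateSpace P I, ∀ t ∈ stateSpace P I, Leads P s t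

open Classical in
/-- `avoidProb P t n s` is the probability that the chain started in `s` does not visit `t` at any
of the times `1, …, n`, that is, `ℙ_s (T > n)` where `T` is the first time `≥ 1` at which the
chain is in state `t`. -/
noncomputable def avoidProb (P : S → S → ℝ≥0∞) (t : S) : ℕ → S → ℝ≥0∞
  | 0, _ => 1
  | n + 1, s => ∑' s', if s' = t then 0 else P s s' * avoidProb P t n s'

/-- The expected return time `𝔼_s [T] = ∑ₙ ℙ_s (T > n)` to the state `s`, where
`T = inf {n ≥ 1 | chain is in s at time n}`. -/
noncomputable def meanReturnTime (P : S → S → ℝ≥0∞) (s : S) : ℝ≥0∞ :=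
  ∑' n, avoidProb P s n s

/-- Every state of the chain has a finite expected return time. -/
def IsPositiveRecurrent (P : S → S → ℝ≥0∞) (I : Set S) : Prop :=
  ∀ s ∈ stateSpace P I, meanReturnTime P s < ∞

end MarkovChain

namespace SPII

/-! ### Schedules -/

/-- The standing assumptions on a finite schedule set: it is monotone, it contains a positive
multiple of every unit vector, and it has at least two distinct maximal elements. -/
structure IsScheduleSet {N : ℕ} (Sched : Finset (Fin N → ℕ)) : Prop where
  monotone : ∀ d ∈ Sched, ∀ d' : Fin N → ℕ, d' ≤ d → d' ∈ Sched
  nondegenerate : ∃ c : ℕ, 0 < c ∧ ∀ i, Pi.single i c ∈ Sched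
  two_maximal : ∃ d₁ d₂ : Fin N → ℕ, d₁ ≠ d₂ ∧
    Maximal (fun d => d ∈ Sched) d₁ ∧ Maximal (fun d => d ∈ Sched) d₂

/-- The convex hull of the schedule set in `ℝ^N`. -/
def scheduleHull {N : ℕ} (Sched : Finset (Fin N → ℕ)) : Set (Fin N → ℝ) :=
  convexHull ℝ ((fun (d : Fin N → ℕ) (i : Fin N) => (d i : ℝ)) '' (Sched : Set (Fin N → ℕ)))

/-- The maximum capacity region: nonnegative vectors that are strictly dominated (in every
coordinate) by some point of the convex hull of the schedule set. -/
def maxCapacityRegion {N : ℕ} (Sched : Finset (Fin N → ℕ)) : Set (Fin N → ℝ) :=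
  {lam | (∀ i, 0 ≤ lam i) ∧ ∃ y ∈ scheduleHull Sched, ∀ i, lam i < y i}

/-! ### Channels -/

/-- A channel with finite input alphabet `X` and output alphabet `Y`: a row stochastic matrix. -/
structure Channel (X Y : Type*) [Fintype Y] where
  prob : Matrix X Y ℝ
  nonneg : ∀ x y, 0 ≤ prob x y
  sum_eq_one : ∀ x, ∑ y, prob x y = 1

/-- The channel matrix has at least two distinct rows. -/
def Channel.IsInformative {X Y : Type*} [Fintype Y] (C : Channel X Y) : Prop :=
  ∃ x₁ x₂, C.prob x₁ ≠ C.prob x₂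

/-! ### Memories and policies -/

/-- The contents of a memory of `k` bits. -/
abbrev Memory (k : ℕ) : Type := Fin k → Bool

/-- An encoding policy with `k` bits of memory and without memory-feedback:
`(X(t), M_e(t)) = act Q(t-1) A(t-1) M_e(t-1) U_e(t-1)`, together with the signal and the memory
contents at time `0`. Arrivals are encoded as `true` (one arrival) and `false` (none). -/
structure EncodingPolicy (N : ℕ) (X : Type*) (k : ℕ) where
  act : (Fin N → ℕ) → (Fin N → Bool) → Memory k → ℝ → X × Memory k
  measurable_act : ∀ q a m r, MeasurableSet {u : ℝ | act q a m u = r}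
  initSignal : X
  initMem : Memory k

/-- An allocation policy with `v` bits of memory:
`D(t) = alloc Y(t) M_r(t-1) U_r(t-1)` and `M_r(t) = update Y(t-1) M_r(t-1) U_r(t-1)`,
together with the memory contents at time `0`. -/
structure AllocationPolicy {N : ℕ} (Sched : Finset (Fin N → ℕ)) (Y : Type*) (v : ℕ) where
  alloc : Y → Memory v → ℝ → (Fin N → ℕ)
  alloc_mem : ∀ y m u, alloc y m u ∈ Sched
  measurable_alloc : ∀ y m d, MeasurableSet {u : ℝ | alloc y m u = d}
  update : Y → Memory v → ℝ → Memory v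
  measurable_update : ∀ y m m', MeasurableSet {u : ℝ | update y m u = m'}
  initMem : Memory v

/-! ### The system -/

/-- The system state `(Q(t), A(t), M_e(t), X(t), M_r(t))` together with the message `Y(t)`. The
message is needed for the Markov property, since `M_r(t+1)` depends on `Y(t)`, which is correlated
with `Q(t)` through `D(t)`. -/
@[ext]
structure State (N : ℕ) (X Y : Type*) (k v : ℕ) where
  queue : Fin N → ℕ
  arrivals : Fin N → Bool
  encMem : Memory k
  signal : X
  recMem : Memory v
  message : Y

section System

variable {N : ℕ} {Sched : Finset (Fin N → ℕ)} {X Y : Type*} {k v : ℕ}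

/-- The state at time `t` if the state at time `t - 1` is `s`, the arrivals are `A(t) = a`, the
message is `Y(t) = y`, and the randomization variables are `U_e(t-1) = ue`, `U_r(t-1) = ur`. The
queues follow `Q(t) = (Q(t-1) - D(t))⁺ + A(t)` (subtraction in `ℕ` is truncated at `0`). -/
def nextState (φ : EncodingPolicy N X k) (ψ : AllocationPolicy Sched Y v) (s : State N X Y k v)
    (a : Fin N → Bool) (y : Y) (ue ur : ℝ) : State N X Y k v where
  queue := fun i => (s.queue i - ψ.alloc y s.recMem ur i) + (a i).toNat
  arrivals := a
  encMem := (φ.act s.queue s.arrivals s.encMem ue).2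
  signal := (φ.act s.queue s.arrivals s.encMem ue).1
  recMem := ψ.update s.message s.recMem ur
  message := y

/-- The probability of the arrival vector `a` when the arrivals to the queues `i` are independent
Bernoulli variables with means `lam i`. -/
noncomputable def arrivalProb (lam : Fin N → ℝ) (a : Fin N → Bool) : ℝ≥0∞ :=
  ∏ i, ENNReal.ofReal (if a i then lam i else 1 - lam i)

open Classical in
/-- The transition matrix of the system under arrival rates `lam`: `U_e` and `U_r` are independent
and uniform on `(0, 1)`, the arrivals are independent of everything else, and the message is drawn
from the row of the channel matrix that belongs to the signal just sent. -/
noncomputable def transition [Fintype Y] (C : Channel X Y) (φ : EncodingPolicy N X k)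
    (ψ : AllocationPolicy Sched Y v) (lam : Fin N → ℝ) (s s' : State N X Y k v) : ℝ≥0∞ :=
  ∑ a : Fin N → Bool, ∑ y : Y,
    ∫⁻ ue in Set.Ioo (0 : ℝ) 1, ∫⁻ ur in Set.Ioo (0 : ℝ) 1,
      arrivalProb lam a *
        ENNReal.ofReal (C.prob (φ.act s.queue s.arrivals s.encMem ue).1 y) *
        (if nextState φ ψ s a y ue ur = s' then 1 else 0)

/-- The possible initial states: the queues are empty, the encoder and the receiver start from the
memory contents that the policies prescribe, and the message is a possible channel output for the
initial signal. -/
def initialStates [Fintype Y] (C : Channel X Y) (φ : EncodingPolicy N X k)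
    (ψ : AllocationPolicy Sched Y v) : Set (State N X Y k v) :=
  {s | s.queue = 0 ∧ s.arrivals = (fun _ => false) ∧ s.encMem = φ.initMem ∧
    s.signal = φ.initSignal ∧ s.recMem = ψ.initMem ∧ 0 < C.prob s.signal s.message}

/-- `lam` is a vector of means of Bernoulli arrivals. Mean `1` is left out: such a queue receives a
job in every slot, so that the chain started from the empty system is not irreducible. -/
def IsArrivalRate (lam : Fin N → ℝ) : Prop := ∀ i, 0 ≤ lam i ∧ lam i < 1

/-- Policy pairs under which the system is an irreducible Markov chain, whatever the rates. -/
def IsIrreduciblePair [Fintype Y] (C : Channel X Y) (φ : EncodingPolicy N X k)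
    (ψ : AllocationPolicy Sched Y v) : Prop :=
  ∀ lam : Fin N → ℝ, IsArrivalRate lam →
    MarkovChain.IsIrreducible (transition C φ ψ lam) (initialStates C φ ψ)

/-- The capacity region of a policy pair: the arrival rate vectors under which the system is
stable, that is, positive recurrent. -/
def capacityRegion [Fintype Y] (C : Channel X Y) (φ : EncodingPolicy N X k)
    (ψ : AllocationPolicy Sched Y v) : Set (Fin N → ℝ) :=
  {lam | IsArrivalRate lam ∧
    MarkovChain.IsPositiveRecurrent (transition C φ ψ lam) (initialStates C φ ψ)}

/-- The capacity factor of a policy pair: the supremum of all `ρ ≥ 0` such that every arrival rate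
vector in `ρ Λ` belongs to the capacity region of the pair. -/
noncomputable def pairCapacityFactor [Fintype Y] (C : Channel X Y) (φ : EncodingPolicy N X k)
    (ψ : AllocationPolicy Sched Y v) : ℝ≥0∞ :=
  ⨆ (ρ : ℝ≥0) (_ : ∀ lam ∈ (ρ : ℝ) • maxCapacityRegion Sched,
    IsArrivalRate lam → lam ∈ capacityRegion C φ ψ), (ρ : ℝ≥0∞)

end System

/-- The `(k, v)`-capacity factor of the channel, without memory-feedback: the supremum over all
pairs of an encoding policy with `k` bits and an allocation policy with `v` bits of memory. -/
noncomputable def capacityFactor {N : ℕ} (Sched : Finset (Fin N → ℕ)) {X Y : Type*} [Fintype Y]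
    (C : Channel X Y) (k v : ℕ) : ℝ≥0∞ :=
  ⨆ (φ : EncodingPolicy N X k) (ψ : AllocationPolicy Sched Y v) (_ : IsIrreduciblePair C φ ψ),
    pairCapacityFactor C φ ψ

end SPII

/-! Queue lengths never have to be communicated: a receiver that knows the arrival rates up to a
small error can draw schedules from a distribution whose mean exceeds them. So the encoder only
cycles through the queues, which takes ⌈log₂ N⌉ bits, and reports whether the queue that is due had
an arrival.

Lower bound. Two distinct channel rows give a binary test with probability α of a positive result
under one signal and β > α under the other, so that positive messages about queue j have frequency
p_j = α + (β - α) λ_j. The receiver tracks p_j by an urn of L + 1 balls: each message marks or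
unmarks a random ball, so the deviation of the number of marked balls from (L + 1) p_j contracts in
mean, with noise of bounded variance. As memory is finite, bad estimates recur forever. They are
compensated by a bounded corrector, `potential`, a weighted sum of squared deviations with cross
terms, whose drift is at most -θ ∑ dev² plus a constant (`expect_potential_le`). For θ of order L⁻²
the first term outweighs the loss in every slot with a bad estimate, while the constant is of order
1/L. Hence queue length plus potential tends to decrease, up to truncation at 0, the sum of the
squares is a Lyapunov function (`exists_lyapunov`), and Foster's criterion
(`tsum_avoidProb_lt_top_of_foster`) applies. The chain is irreducible because the system can drain
to its initial states while no jobs arrive (`isIrreduciblePair`).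

Upper bound. Rates outside the hull are separated from the schedules by nonnegative weights; the
weighted queue length then has positive drift and bounded jumps, which forces infinite mean return
times (`meanReturnTime_eq_top_of_drift`). If (1,…,1) is not in the hull, then for every ρ > 1 such
rates exist in ρΛ on the diagonal. -/

/-! ### Mean return times of countable-state chains -/

namespace MarkovChain

variable {S : Type*} {P : S → S → ℝ≥0∞} {t : S}

open Classical in
/-- One step of the chain on functions, on the event that `t` is not hit by this step. -/
noncomputable def tabooStep (P : S → S → ℝ≥0∞) (t : S) (g : S → ℝ≥0∞) (s : S) : ℝ≥0∞ :=
  ∑' s', if s' = t then 0 else P s s' * g s'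

theorem avoidProb_succ (n : ℕ) (s : S) :
    avoidProb P t (n + 1) s = tabooStep P t (avoidProb P t n) s := rfl

theorem tabooStep_mono {g g' : S → ℝ≥0∞} {s : S}
    (h : ∀ s', P s s' ≠ 0 → g s' ≤ g' s') : tabooStep P t g s ≤ tabooStep P t g' s := by
  refine ENNReal.tsum_le_tsum fun s' => ?_
  split_ifs
  · exact le_rfl
  · by_cases h0 : P s s' = 0
    · simp [h0]
    · gcongr
      exact h s' h0

theorem tabooStep_add (g g' : S → ℝ≥0∞) (s : S) :
    tabooStep P t (fun x => g x + g' x) s = tabooStep P t g s + tabooStep P t g' s := by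
  unfold tabooStep
  rw [← ENNReal.tsum_add]
  congr 1 with s'
  split_ifs <;> simp [mul_add]

theorem tabooStep_const_mul (c : ℝ≥0∞) (g : S → ℝ≥0∞) (s : S) :
    tabooStep P t (fun x => c * g x) s = c * tabooStep P t g s := by
  unfold tabooStep
  rw [← ENNReal.tsum_mul_left]
  congr 1 with s'
  split_ifs
  · simp
  · ring

theorem tabooStep_le (g : S → ℝ≥0∞) (s : S) : tabooStep P t g s ≤ ∑' s', P s s' * g s' := by
  refine ENNReal.tsum_le_tsum fun s' => ?_
  split_ifs <;> simp

theorem tabooStep_of_eq_zero {g : S → ℝ≥0∞} (hg : g t = 0) (s : S) :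
    tabooStep P t g s = ∑' s', P s s' * g s' := by
  unfold tabooStep
  congr 1 with s'
  split_ifs with h
  · simp [h, hg]
  · rfl

theorem tabooStep_const_le (hP : ∀ s, ∑' s', P s s' = 1) (c : ℝ≥0∞) (s : S) :
    tabooStep P t (fun _ => c) s ≤ c := by
  refine (tabooStep_le _ _).trans ?_
  rw [ENNReal.tsum_mul_right, hP, one_mul]

theorem tabooStep_sum (n : ℕ) (g : ℕ → S → ℝ≥0∞) (s : S) :
    tabooStep P t (fun x => ∑ j ∈ Finset.range n, g j x) s
      = ∑ j ∈ Finset.range n, tabooStep P t (g j) s := by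
  induction n with
  | zero => simp [tabooStep]
  | succ n ih => simp only [Finset.sum_range_succ, tabooStep_add, ih]

theorem avoidProb_le_one (hP : ∀ s, ∑' s', P s s' = 1) (n : ℕ) (s : S) :
    avoidProb P t n s ≤ 1 := by
  induction n generalizing s with
  | zero => exact le_rfl
  | succ n ih =>
    rw [avoidProb_succ]
    exact (tabooStep_mono fun s' _ => ih s').trans (tabooStep_const_le hP 1 s)

theorem avoidProb_antitone (hP : ∀ s, ∑' s', P s s' = 1) (s : S) :
    Antitone fun n => avoidProb P t n s := by
  refine antitone_nat_of_succ_le fun n => ?_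
  induction n generalizing s with
  | zero => exact avoidProb_le_one hP _ _
  | succ n ih =>
    rw [avoidProb_succ, avoidProb_succ n]
    exact tabooStep_mono fun s' _ => ih s'

/-- The expectation of the minimum of `n` and the hitting time of `t`. -/
noncomputable def truncTime (P : S → S → ℝ≥0∞) (t : S) (n : ℕ) (s : S) : ℝ≥0∞ :=
  ∑ j ∈ Finset.range n, avoidProb P t j s

theorem truncTime_succ (n : ℕ) (s : S) :
    truncTime P t (n + 1) s = 1 + tabooStep P t (truncTime P t n) s := by
  unfold truncTime
  rw [Finset.sum_range_succ', tabooStep_sum, add_comm]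
  rfl

theorem truncTime_le (hP : ∀ s, ∑' s', P s s' = 1) (n : ℕ) (s : S) :
    truncTime P t n s ≤ n := by
  unfold truncTime
  refine (Finset.sum_le_sum fun j _ => avoidProb_le_one hP j s).trans ?_
  simp

theorem truncTime_mono (s : S) : Monotone fun n => truncTime P t n s := fun _ _ h =>
  Finset.sum_le_sum_of_subset (Finset.range_mono h)

/-- A transient drift condition: if `V` vanishes at `t`, has bounded upward jumps and a drift of at
least `ε > 0` in all states, then the mean return time to `t` is infinite. -/
theorem meanReturnTime_eq_top_of_drift (V : S → ℝ≥0∞)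
    (W : ℝ≥0) (ε : ℝ≥0∞) (hε : ε ≠ 0) (hVt : V t = 0)
    (hjump : ∀ s s', P s s' ≠ 0 → V s' ≤ V s + W)
    (hdrift : ∀ s, V s + ε ≤ ∑' s', P s s' * V s') : meanReturnTime P t = ∞ := by
  -- `f n s` is the expectation of V at time n on the event T > n. From `t` it is at least ε for n ≥
  -- 1 and at most W n ℙ(T > n), so ℙ(T > n) decays no faster than 1/n and its sum diverges.
  let f : ℕ → S → ℝ≥0∞ := fun n => (tabooStep P t)^[n] V
  have fsucc : ∀ n s, f (n + 1) s = tabooStep P t (f n) s := fun n s => by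
    simp only [f, Function.iterate_succ_apply']
  have hle : ∀ n s, f n s ≤ (V s + W * n) * avoidProb P t n s := by
    intro n
    induction n with
    | zero => intro s; simp [f, avoidProb]
    | succ n ih =>
      intro s
      rw [fsucc, avoidProb_succ, ← tabooStep_const_mul]
      refine tabooStep_mono fun s' h' => (ih s').trans ?_
      gcongr ?_ * _
      calc V s' + W * n ≤ V s + W + W * n := by gcongr; exact hjump s s' h'
        _ = V s + W * (n + 1 : ℕ) := by push_cast; ring
  have hge : ∀ n s, f n s + ε * avoidProb P t n s ≤ f (n + 1) s := by
    intro n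
    induction n with
    | zero =>
      intro s
      -- Since V vanishes at `t`, killing the chain there loses nothing in one step, and the full
      -- drift is available.
      rw [fsucc, show f 0 = V from rfl, tabooStep_of_eq_zero hVt]
      simpa [avoidProb] using hdrift s
    | succ n ih =>
      intro s
      rw [fsucc (n + 1), fsucc n, avoidProb_succ, ← tabooStep_const_mul, ← tabooStep_add]
      exact tabooStep_mono fun s' _ => ih s'
  have hεf : ∀ n, ε ≤ f (n + 1) t := by
    intro n
    induction n with
    | zero => simpa [f, hVt, avoidProb] using hge 0 t
    | succ n ih => exact ih.trans (le_self_add.trans (hge (n + 1) t))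
  by_contra hfin
  have hbound : ∀ n : ℕ, ε * ((n : ℝ≥0∞) + 1)⁻¹ ≤ W * avoidProb P t (n + 1) t := by
    intro n
    rw [← div_eq_mul_inv]
    refine ENNReal.div_le_of_le_mul ?_
    have := (hεf n).trans (hle (n + 1) t)
    rw [hVt, zero_add] at this
    refine this.trans (le_of_eq ?_)
    push_cast
    ring
  have hsum : ∑' n : ℕ, ε * ((n : ℝ≥0∞) + 1)⁻¹ ≠ ∞ := by
    refine ne_top_of_le_ne_top (b := W * meanReturnTime P t) (ENNReal.mul_ne_top (by simp) hfin) ?_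
    refine (ENNReal.tsum_le_tsum hbound).trans ?_
    rw [ENNReal.tsum_mul_left]
    gcongr
    unfold meanReturnTime
    exact ENNReal.tsum_comp_le_tsum_of_injective (add_left_injective 1) fun n => avoidProb P t n t
  rw [ENNReal.tsum_mul_left] at hsum
  have hsum' : ∑' n : ℕ, ((n : ℝ≥0∞) + 1)⁻¹ ≠ ∞ := fun h => hsum (by rw [h, ENNReal.mul_top hε])
  have hs : Summable fun n : ℕ => ((n : ℝ≥0) + 1)⁻¹ := by
    rw [← ENNReal.tsum_coe_ne_top_iff_summable]
    convert hsum' using 4 with n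
    rw [ENNReal.coe_inv (by positivity)]
    simp
  have hs2 : Summable fun n : ℕ => (1 : ℝ) / n := by
    rw [← summable_nat_add_iff 1]
    exact (NNReal.summable_coe.2 hs).congr fun n => by simp
  exact Real.not_summable_one_div_natCast hs2

/-- **Foster's criterion.** On a closed set `C` of states, let `V` have drift at most `-1` off a
finite set `F` and drift at most `b` everywhere. If `t` can be hit from every state of `F`, then the
mean hitting time of `t` is finite from every state of `C`. -/
theorem tsum_avoidProb_lt_top_of_foster (hP : ∀ s, ∑' s', P s s' = 1) (C : Set S)
    (hC : ∀ s ∈ C, ∀ s', P s s' ≠ 0 → s' ∈ C) (F : Set S) (hF : F.Finite) (hFC : F ⊆ C)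
    (V : S → ℝ≥0∞) (hV : ∀ s ∈ C, V s ≠ ∞) (b : ℝ≥0)
    (hdrift : ∀ s ∈ C, s ∉ F → ∑' s', P s s' * V s' + 1 ≤ V s)
    (hb : ∀ s ∈ C, ∑' s', P s s' * V s' ≤ V s + b)
    (hhit : ∀ s ∈ F, ∃ n, avoidProb P t n s < 1) {s : S} (hs : s ∈ C) :
    ∑' n, avoidProb P t n s < ∞ := by
  classical
  -- Truncation at n keeps `B n` finite, so that `q * B n` can be subtracted below.
  let B : ℕ → ℝ≥0∞ := fun n => ⨆ x ∈ F, truncTime P t n x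
  have hBfin : ∀ n, B n ≠ ∞ := fun n =>
    ne_top_of_le_ne_top (ENNReal.natCast_ne_top n) (iSup₂_le fun x _ => truncTime_le hP n x)
  have hBmono : Monotone B := fun m n h => iSup₂_mono fun x _ => truncTime_mono x h
  have hFle : ∀ n, ∀ x ∈ F, truncTime P t n x ≤ B n := fun n x hx =>
    le_iSup₂ (f := fun x (_ : x ∈ F) => truncTime P t n x) x hx
  -- Off F the drift -1 pays for each step; once F is entered, at most `B n` remains.
  have hoff : ∀ n, ∀ s ∈ C, truncTime P t n s ≤ V s + B n := by
    intro n
    induction n with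
    | zero => intro s _; simp [truncTime]
    | succ n ih =>
      intro s hs
      by_cases hsF : s ∈ F
      · exact (hFle _ s hsF).trans le_add_self
      rw [truncTime_succ]
      calc 1 + tabooStep P t (truncTime P t n) s
          ≤ 1 + tabooStep P t (fun s' => V s' + B n) s := by
            gcongr
            exact tabooStep_mono fun s' h' => ih s' (hC s hs s' h')
        _ ≤ 1 + (∑' s', P s s' * V s' + B n) := by
            rw [tabooStep_add]
            gcongr
            · exact tabooStep_le _ _
            · exact tabooStep_const_le hP _ _
        _ = (∑' s', P s s' * V s' + 1) + B n := by ring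
        _ ≤ V s + B (n + 1) := by
            gcongr
            · exact hdrift s hs hsF
            · exact hBmono n.le_succ
  -- K initial steps cost one unit of time and at most b of V each; only if they miss `t` is `B n`
  -- still to be paid.
  have hstep : ∀ n K, ∀ s ∈ C,
      truncTime P t (n + K) s ≤ (K * (1 + b) + V s) + avoidProb P t K s * B n := by
    intro n K
    induction K with
    | zero => intro s hs; simpa [avoidProb] using hoff n s hs
    | succ K ih =>
      intro s hs
      rw [← add_assoc, truncTime_succ, avoidProb_succ]
      calc 1 + tabooStep P t (truncTime P t (n + K)) s
          ≤ 1 + tabooStep P t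
              (fun s' => (K * (1 + b) + V s') + B n * avoidProb P t K s') s := by
            gcongr
            refine tabooStep_mono fun s' h' => ?_
            rw [mul_comm (B n)]
            exact ih s' (hC s hs s' h')
        _ ≤ 1 + ((K * (1 + b) + (V s + b)) + B n * tabooStep P t (avoidProb P t K) s) := by
            rw [tabooStep_add, tabooStep_add, tabooStep_const_mul (B n)]
            gcongr
            · exact tabooStep_const_le hP _ _
            · exact (tabooStep_le _ _).trans (hb s hs)
        _ = ((K + 1 : ℕ) * (1 + b) + V s) + tabooStep P t (avoidProb P t K) s * B n := by
            push_cast; ring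
  choose! m hm using hhit
  obtain ⟨K, hK⟩ : ∃ K, ∀ x ∈ F, m x ≤ K :=
    ⟨hF.toFinset.sup m, fun x hx => Finset.le_sup (f := m) (hF.mem_toFinset.2 hx)⟩
  let q : ℝ≥0∞ := hF.toFinset.sup fun x => avoidProb P t K x
  have hq : q < 1 := by
    rw [Finset.sup_lt_iff (by simp)]
    intro x hx
    rw [hF.mem_toFinset] at hx
    exact (avoidProb_antitone hP x (hK x hx)).trans_lt (hm x hx)
  let c : ℝ≥0∞ := K * (1 + b) + hF.toFinset.sup V
  have hc : c ≠ ∞ := by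
    refine ENNReal.add_ne_top.2 ⟨ENNReal.mul_ne_top (by simp) (by simp), ?_⟩
    rw [← lt_top_iff_ne_top, Finset.sup_lt_iff (by simp)]
    intro x hx
    exact (hV x (hFC (hF.mem_toFinset.1 hx))).lt_top
  -- From F, `t` is missed in K steps with probability at most q < 1. Hence B n ≤ c + q B n, a bound
  -- uniform in n.
  have hB : ∀ n, B n ≤ c / (1 - q) := by
    intro n
    have h1 : B n ≤ c + q * B n := by
      refine iSup₂_le fun x hx => ?_
      refine (truncTime_mono x (Nat.le_add_right n K)).trans ((hstep n K x (hFC hx)).trans ?_)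
      have hx' := hF.mem_toFinset.2 hx
      gcongr
      · exact add_le_add_right (Finset.le_sup (f := V) hx') _
      · exact Finset.le_sup (f := fun x => avoidProb P t K x) hx'
    have h2 : B n * (1 - q) ≤ c := by
      rw [ENNReal.mul_sub (fun _ _ => hBfin n), mul_one, mul_comm]
      exact tsub_le_iff_right.2 h1
    rw [ENNReal.le_div_iff_mul_le (Or.inl (tsub_pos_of_lt hq).ne') (Or.inl (by simp))]
    exact h2
  have hfin : V s + c / (1 - q) < ∞ :=
    ENNReal.add_lt_top.2 ⟨(hV s hs).lt_top, ENNReal.div_lt_top hc (tsub_pos_of_lt hq).ne'⟩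
  refine lt_of_le_of_lt ?_ hfin
  rw [ENNReal.tsum_eq_iSup_nat]
  exact iSup_le fun n => (hoff n s hs).trans (by gcongr; exact hB n)

theorem avoidProb_one_lt_one (hP : ∀ s, ∑' s', P s s' = 1) {s : S} (h : 0 < P s t) :
    avoidProb P t 1 s < 1 := by
  classical
  have h1 : avoidProb P t 1 s + P s t ≤ 1 := by
    rw [← hP s, ENNReal.tsum_eq_add_tsum_ite t (f := P s), add_comm]
    gcongr
    rw [avoidProb_succ]
    unfold tabooStep
    refine ENNReal.tsum_le_tsum fun s' => ?_
    split_ifs <;> simp [avoidProb]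
  have hfin : avoidProb P t 1 s ≠ ∞ :=
    ne_top_of_le_ne_top (by simp) (avoidProb_le_one hP 1 s)
  exact (ENNReal.lt_add_right hfin h.ne').trans_le h1

theorem avoidProb_succ_lt_one (hP : ∀ s, ∑' s', P s s' = 1) {s s' : S} (h : 0 < P s s') {n : ℕ}
    (hn : avoidProb P t n s' < 1) : avoidProb P t (n + 1) s < 1 := by
  classical
  by_cases hst : s' = t
  · subst hst
    exact (avoidProb_antitone hP s (Nat.le_add_left 1 n)).trans_lt (avoidProb_one_lt_one hP h)
  rw [avoidProb_succ, ← hP s]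
  have hfin : ∑' x, P s x ≠ ∞ := by simp [hP]
  have hle : ∀ x, (if x = t then 0 else P s x * avoidProb P t n x) ≤ P s x := by
    intro x
    split_ifs
    · simp
    · exact mul_le_of_le_one_right' (avoidProb_le_one hP n x)
  refine ENNReal.tsum_lt_tsum (ne_top_of_le_ne_top hfin (ENNReal.tsum_le_tsum hle)) hle (i := s') ?_
  rw [if_neg hst]
  have hPfin : P s s' ≠ ∞ := ne_top_of_le_ne_top hfin (ENNReal.le_tsum s')
  calc P s s' * avoidProb P t n s' < P s s' * 1 := (ENNReal.mul_lt_mul_iff_right h.ne' hPfin).2 hn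
    _ = P s s' := mul_one _

theorem exists_avoidProb_lt_one (hP : ∀ s, ∑' s', P s s' = 1) {s : S}
    (h : Relation.TransGen (fun s t => 0 < P s t) s t) : ∃ n, avoidProb P t n s < 1 := by
  induction h using Relation.TransGen.head_induction_on with
  | single h => exact ⟨1, avoidProb_one_lt_one hP h⟩
  | head h _ ih =>
    obtain ⟨n, hn⟩ := ih
    exact ⟨n + 1, avoidProb_succ_lt_one hP h hn⟩

theorem mem_stateSpace_of_pos {I : Set S} {s s' : S} (hs : s ∈ stateSpace P I)
    (h : P s s' ≠ 0) : s' ∈ stateSpace P I := by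
  obtain ⟨s₀, h0, h1⟩ := hs
  exact ⟨s₀, h0, h1.tail (pos_iff_ne_zero.2 h)⟩

/-- Return times need paths with at least one step, whereas `Leads` admits the empty path. A first
step exists because rows sum to one, and irreducibility completes the path. -/
theorem IsIrreducible.transGen (hP : ∀ s, ∑' s', P s s' = 1) {I : Set S} (h : IsIrreducible P I)
    {s t : S} (hs : s ∈ stateSpace P I) (ht : t ∈ stateSpace P I) :
    Relation.TransGen (fun s t => 0 < P s t) s t := by
  obtain ⟨s', hs'⟩ : ∃ s', P s s' ≠ 0 := by
    by_contra! h0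
    have := hP s
    simp [h0] at this
  exact Relation.TransGen.head' (pos_iff_ne_zero.2 hs')
    (h s' (mem_stateSpace_of_pos hs hs') t ht)

/-- Foster's criterion for an irreducible chain. -/
theorem IsIrreducible.isPositiveRecurrent (hP : ∀ s, ∑' s', P s s' = 1) {I : Set S}
    (h : IsIrreducible P I) (F : Set S) (hF : (F ∩ stateSpace P I).Finite)
    (V : S → ℝ≥0∞) (hV : ∀ s, V s ≠ ∞) (b : ℝ≥0)
    (hdrift : ∀ s ∈ stateSpace P I, s ∉ F → ∑' s', P s s' * V s' + 1 ≤ V s)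
    (hb : ∀ s ∈ stateSpace P I, ∑' s', P s s' * V s' ≤ V s + b) : IsPositiveRecurrent P I := by
  intro t ht
  refine tsum_avoidProb_lt_top_of_foster hP (stateSpace P I) (fun s hs s' => mem_stateSpace_of_pos hs)
    (F ∩ stateSpace P I) hF Set.inter_subset_right V (fun s _ => hV s) b
    (fun s hs hsF => hdrift s hs fun hF => hsF ⟨hF, hs⟩) hb (fun s hs => ?_) ht
  exact exists_avoidProb_lt_one hP (h.transGen hP hs.2 ht)

end MarkovChain

/-! ### One step of the system -/

namespace SPII

section System

variable {N : ℕ} {Sched : Finset (Fin N → ℕ)} {X Y : Type*} {k v : ℕ}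

theorem State.countable [Countable X] [Countable Y] : Countable (State N X Y k v) := by
  let f : State N X Y k v → (Fin N → ℕ) × (Fin N → Bool) × Memory k × X × Memory v × Y :=
    fun s => (s.queue, s.arrivals, s.encMem, s.signal, s.recMem, s.message)
  refine Function.Injective.countable (f := f) fun s s' h => ?_
  simp only [f, Prod.mk.injEq] at h
  exact State.ext h.1 h.2.1 h.2.2.1 h.2.2.2.1 h.2.2.2.2.1 h.2.2.2.2.2

/-- Only level sets of the policies are known to be measurable; countability of the range does the
rest. -/
theorem EncodingPolicy.measurable_comp_act [Countable X] (φ : EncodingPolicy N X k)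
    (q : Fin N → ℕ) (a : Fin N → Bool) (m : Memory k) (f : X × Memory k → ℝ≥0∞) :
    Measurable fun u => f (φ.act q a m u) := by
  let _ : MeasurableSpace X := ⊤
  have h : Measurable (φ.act q a m) :=
    measurable_to_countable' fun r => φ.measurable_act q a m r
  exact (Measurable.of_discrete (f := f)).comp h

theorem AllocationPolicy.measurable_comp (ψ : AllocationPolicy Sched Y v) (y y' : Y)
    (m : Memory v) (f : (Fin N → ℕ) → Memory v → ℝ≥0∞) :
    Measurable fun u => f (ψ.alloc y m u) (ψ.update y' m u) := by
  have h1 : Measurable (ψ.alloc y m) :=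
    measurable_to_countable' fun r => ψ.measurable_alloc y m r
  have h2 : Measurable (ψ.update y' m) :=
    measurable_to_countable' fun r => ψ.measurable_update y' m r
  exact (Measurable.of_discrete (f := Function.uncurry f)).comp (h1.prodMk h2)

variable [Fintype Y]

/-- The expectation of `g` after one step. -/
theorem tsum_transition_mul [Countable X] (C : Channel X Y) (φ : EncodingPolicy N X k)
    (ψ : AllocationPolicy Sched Y v) (lam : Fin N → ℝ) (s : State N X Y k v)
    (g : State N X Y k v → ℝ≥0∞) :
    ∑' s', transition C φ ψ lam s s' * g s' = ∑ a : Fin N → Bool, ∑ y : Y,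
      ∫⁻ ue in Set.Ioo (0 : ℝ) 1, ∫⁻ ur in Set.Ioo (0 : ℝ) 1, arrivalProb lam a *
        ENNReal.ofReal (C.prob (φ.act s.queue s.arrivals s.encMem ue).1 y) *
          g (nextState φ ψ s a y ue ur) := by
  classical
  have : Countable (State N X Y k v) := State.countable
  have hmr : ∀ (a : Fin N → Bool) (y : Y) (ue : ℝ) (f : State N X Y k v → ℝ≥0∞),
      Measurable fun ur => f (nextState φ ψ s a y ue ur) := fun a y ue f =>
    ψ.measurable_comp y s.message s.recMem fun d m => f
      ⟨fun i => (s.queue i - d i) + (a i).toNat, a, (φ.act s.queue s.arrivals s.encMem ue).2,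
        (φ.act s.queue s.arrivals s.encMem ue).1, m, y⟩
  have hme : ∀ (a : Fin N → Bool) (y : Y) (f : State N X Y k v → ℝ≥0∞),
      Measurable fun ue => ∫⁻ ur in Set.Ioo (0 : ℝ) 1, arrivalProb lam a *
        ENNReal.ofReal (C.prob (φ.act s.queue s.arrivals s.encMem ue).1 y) *
          f (nextState φ ψ s a y ue ur) := fun a y f =>
    φ.measurable_comp_act s.queue s.arrivals s.encMem fun e =>
      ∫⁻ ur in Set.Ioo (0 : ℝ) 1, arrivalProb lam a * ENNReal.ofReal (C.prob e.1 y) *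
        f ⟨fun i => (s.queue i - ψ.alloc y s.recMem ur i) + (a i).toNat, a, e.2, e.1,
          ψ.update s.message s.recMem ur, y⟩
  unfold transition
  simp_rw [Finset.sum_mul]
  rw [Summable.tsum_finsetSum fun _ _ => ENNReal.summable]
  refine Finset.sum_congr rfl fun a _ => ?_
  rw [Summable.tsum_finsetSum fun _ _ => ENNReal.summable]
  refine Finset.sum_congr rfl fun y _ => ?_
  have hpt : ∀ s', (∫⁻ ue in Set.Ioo (0 : ℝ) 1, ∫⁻ ur in Set.Ioo (0 : ℝ) 1, arrivalProb lam a *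
        ENNReal.ofReal (C.prob (φ.act s.queue s.arrivals s.encMem ue).1 y) *
          (if nextState φ ψ s a y ue ur = s' then 1 else 0)) * g s' =
      ∫⁻ ue in Set.Ioo (0 : ℝ) 1, ∫⁻ ur in Set.Ioo (0 : ℝ) 1, arrivalProb lam a *
        ENNReal.ofReal (C.prob (φ.act s.queue s.arrivals s.encMem ue).1 y) *
          (if nextState φ ψ s a y ue ur = s' then g s' else 0) := by
    intro s'
    rw [← lintegral_mul_const _ (hme a y fun x => if x = s' then 1 else 0)]
    refine lintegral_congr fun ue => ?_
    rw [← lintegral_mul_const _ ((hmr a y ue fun x => if x = s' then 1 else 0).const_mul _)]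
    refine lintegral_congr fun ur => ?_
    rw [mul_assoc, ite_mul, one_mul, zero_mul]
  simp_rw [hpt]
  rw [← lintegral_tsum fun s' => (hme a y fun x => if x = s' then g s' else 0).aemeasurable]
  refine lintegral_congr fun ue => ?_
  rw [← lintegral_tsum fun s' =>
    ((hmr a y ue fun x => if x = s' then g s' else 0).const_mul _).aemeasurable]
  refine lintegral_congr fun ur => ?_
  rw [ENNReal.tsum_mul_left]
  congr 1
  exact (tsum_eq_single (nextState φ ψ s a y ue ur) fun s' h => if_neg (Ne.symm h)).trans
    (if_pos rfl)

/-- If `g` after the step depends on the arrivals only, its expectation is a sum over arrivals. -/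
theorem sum_lintegral_arrivals [Countable X] (C : Channel X Y) (φ : EncodingPolicy N X k)
    (lam : Fin N → ℝ) (s : State N X Y k v) (c : (Fin N → Bool) → ℝ≥0∞) :
    ∑ a : Fin N → Bool, ∑ y : Y,
      ∫⁻ ue in Set.Ioo (0 : ℝ) 1, ∫⁻ _ in Set.Ioo (0 : ℝ) 1, arrivalProb lam a *
        ENNReal.ofReal (C.prob (φ.act s.queue s.arrivals s.encMem ue).1 y) * c a =
      ∑ a : Fin N → Bool, arrivalProb lam a * c a := by
  refine Finset.sum_congr rfl fun a _ => ?_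
  have h1 : ∀ x, ∑ y : Y, ENNReal.ofReal (C.prob x y) = 1 := fun x => by
    rw [← ENNReal.ofReal_sum_of_nonneg fun y _ => C.nonneg x y, C.sum_eq_one, ENNReal.ofReal_one]
  simp only [lintegral_const, Measure.restrict_apply MeasurableSet.univ, Set.univ_inter,
    Real.volume_Ioo, sub_zero, ENNReal.ofReal_one, mul_one]
  rw [← lintegral_finsetSum _ fun y _ =>
    φ.measurable_comp_act s.queue s.arrivals s.encMem fun e =>
      arrivalProb lam a * ENNReal.ofReal (C.prob e.1 y) * c a]
  simp_rw [← Finset.sum_mul, ← Finset.mul_sum, h1]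
  simp

/-- The weight of an arrival vector, as a real number. -/
noncomputable def arrivalWeight (lam : Fin N → ℝ) (a : Fin N → Bool) : ℝ :=
  ∏ i, (if a i then lam i else 1 - lam i)

theorem IsArrivalRate.ite_nonneg {lam : Fin N → ℝ} (h : IsArrivalRate lam) (b : Bool) (i : Fin N) :
    0 ≤ (if b then lam i else 1 - lam i) := by
  have := h i
  split_ifs <;> linarith

theorem IsArrivalRate.weight_nonneg {lam : Fin N → ℝ} (h : IsArrivalRate lam) (a : Fin N → Bool) :
    0 ≤ arrivalWeight lam a :=
  Finset.prod_nonneg fun i _ => h.ite_nonneg (a i) i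

theorem arrivalProb_eq {lam : Fin N → ℝ} (h : IsArrivalRate lam) (a : Fin N → Bool) :
    arrivalProb lam a = ENNReal.ofReal (arrivalWeight lam a) := by
  unfold arrivalProb arrivalWeight
  rw [ENNReal.ofReal_prod_of_nonneg fun i _ => h.ite_nonneg (a i) i]

theorem sum_arrivalWeight (lam : Fin N → ℝ) : ∑ a, arrivalWeight lam a = 1 := by
  unfold arrivalWeight
  have := Finset.prod_univ_sum (fun _ : Fin N => (Finset.univ : Finset Bool))
    fun i b => if b then lam i else 1 - lam i
  rw [Fintype.piFinset_univ] at this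
  rw [← this]
  simp

/-- Expansion of a product of sums in which only factor i carries the arrival; the other factors sum
to one. -/
theorem sum_arrivalWeight_mul (lam : Fin N → ℝ) (i : Fin N) :
    ∑ a, arrivalWeight lam a * (a i).toNat = lam i := by
  have := Finset.prod_univ_sum (fun _ : Fin N => (Finset.univ : Finset Bool))
    fun j b => (if b then lam j else 1 - lam j) * if j = i then (b.toNat : ℝ) else 1
  rw [Fintype.piFinset_univ] at this
  calc ∑ a, arrivalWeight lam a * (a i).toNat
      = ∑ a : Fin N → Bool, ∏ j, ((if a j then lam j else 1 - lam j) *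
          if j = i then ((a j).toNat : ℝ) else 1) := by
        refine Finset.sum_congr rfl fun a _ => ?_
        rw [Finset.prod_mul_distrib, Finset.prod_ite_eq' Finset.univ i]
        simp [arrivalWeight]
    _ = lam i := by
        rw [← this, Finset.prod_eq_single i]
        · simp
        · intro j _ hj
          simp [hj]
        · simp

theorem sum_arrivalProb {lam : Fin N → ℝ} (h : IsArrivalRate lam) :
    ∑ a, arrivalProb lam a = 1 := by
  simp_rw [arrivalProb_eq h]
  rw [← ENNReal.ofReal_sum_of_nonneg fun a _ => h.weight_nonneg a, sum_arrivalWeight,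
    ENNReal.ofReal_one]

theorem tsum_transition [Countable X] (C : Channel X Y) (φ : EncodingPolicy N X k)
    (ψ : AllocationPolicy Sched Y v) {lam : Fin N → ℝ} (h : IsArrivalRate lam)
    (s : State N X Y k v) : ∑' s', transition C φ ψ lam s s' = 1 := by
  have h1 := tsum_transition_mul C φ ψ lam s fun _ => 1
  rw [sum_lintegral_arrivals C φ lam s fun _ => 1] at h1
  simpa [sum_arrivalProb h] using h1

theorem exists_nextState_of_transition_ne_zero (C : Channel X Y) (φ : EncodingPolicy N X k)
    (ψ : AllocationPolicy Sched Y v) {lam : Fin N → ℝ} {s s' : State N X Y k v}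
    (h : transition C φ ψ lam s s' ≠ 0) : ∃ a y ue ur, nextState φ ψ s a y ue ur = s' := by
  by_contra! h'
  exact h (by simp [transition, h'])

end System

end SPII

/-! ### The upper bound on the capacity factor -/

namespace SPII

variable {N : ℕ} {Sched : Finset (Fin N → ℕ)} {X Y : Type*} {k v : ℕ}

theorem initialStates_nonempty [Fintype Y] (C : Channel X Y) (φ : EncodingPolicy N X k)
    (ψ : AllocationPolicy Sched Y v) : (initialStates C φ ψ).Nonempty := by
  obtain ⟨y, hy⟩ : ∃ y, 0 < C.prob φ.initSignal y := by
    by_contra! h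
    have := C.sum_eq_one φ.initSignal
    linarith [Finset.sum_nonpos fun y (_ : y ∈ Finset.univ) => h y]
  exact ⟨⟨0, fun _ => false, φ.initMem, φ.initSignal, ψ.initMem, y⟩, rfl, rfl, rfl, rfl, rfl, hy⟩

/-- Rates whose weighted sum exceeds that of every schedule are not stabilized by any policies. -/
theorem notMem_capacityRegion_of_weights [Countable X] [Fintype Y] (C : Channel X Y)
    (φ : EncodingPolicy N X k) (ψ : AllocationPolicy Sched Y v) {lam : Fin N → ℝ} (w : Fin N → ℝ≥0)
    (m : ℝ≥0) (hm : ∀ d ∈ Sched, ∑ i, w i * (d i : ℝ≥0) ≤ m)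
    (hlam : (m : ℝ) < ∑ i, (w i : ℝ) * lam i) : lam ∉ capacityRegion C φ ψ := by
  rintro ⟨hA, hrec⟩
  obtain ⟨t, ht⟩ := initialStates_nonempty C φ ψ
  let V' : (Fin N → ℕ) → ℝ≥0 := fun q => ∑ i, w i * (q i : ℝ≥0)
  let U : (Fin N → Bool) → ℝ≥0 := fun a => ∑ i, w i * ((a i).toNat : ℝ≥0)
  let V : State N X Y k v → ℝ≥0∞ := fun s => V' s.queue
  have hfin := hrec t ⟨t, ht, .refl⟩
  refine hfin.ne (MarkovChain.meanReturnTime_eq_top_of_drift V (∑ i, w i)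
    (ENNReal.ofReal (∑ i, (w i : ℝ) * lam i - m)) ?_ ?_ ?_ ?_)
  · simpa using hlam
  · simp [V, V', ht.1]
  · intro s s' h
    obtain ⟨a, y, ue, ur, rfl⟩ := exists_nextState_of_transition_ne_zero C φ ψ h
    simp only [V, V', nextState]
    rw [← ENNReal.coe_add, ENNReal.coe_le_coe, ← Finset.sum_add_distrib]
    refine Finset.sum_le_sum fun i _ => ?_
    rw [← mul_add_one]
    gcongr
    have h1 : (a i).toNat ≤ 1 := Bool.toNat_le _
    exact_mod_cast add_le_add (Nat.sub_le _ _) h1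
  · intro s
    -- Truncation of the queues at 0 can only raise V. The bound `m` on the service stands on the
    -- right to avoid subtraction in `ℝ≥0∞`.
    have hnext : ∀ a y ue ur,
        ((V' s.queue + U a : ℝ≥0) : ℝ≥0∞) ≤ V (nextState φ ψ s a y ue ur) + m := by
      intro a y ue ur
      simp only [V, V', U, nextState]
      rw [← ENNReal.coe_add, ENNReal.coe_le_coe, ← Finset.sum_add_distrib]
      refine le_trans ?_ (add_le_add_right (hm _ (ψ.alloc_mem y s.recMem ur)) _)
      rw [← Finset.sum_add_distrib]
      refine Finset.sum_le_sum fun i _ => ?_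
      rw [← mul_add, ← mul_add]
      refine mul_le_mul' le_rfl ?_
      have h1 : s.queue i + (a i).toNat ≤ s.queue i - ψ.alloc y s.recMem ur i + (a i).toNat +
          ψ.alloc y s.recMem ur i := by omega
      exact_mod_cast h1
    have hU : ∑ a, arrivalProb lam a * ((V' s.queue + U a : ℝ≥0) : ℝ≥0∞)
        = V s + ENNReal.ofReal (∑ i, (w i : ℝ) * lam i) := by
      have hc : ∀ x : ℝ≥0, (x : ℝ≥0∞) = ENNReal.ofReal x := fun x => by simp
      simp_rw [V, hc, arrivalProb_eq hA]
      rw [← ENNReal.ofReal_add (NNReal.coe_nonneg _)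
        (Finset.sum_nonneg fun i _ => mul_nonneg (w i).coe_nonneg (hA i).1)]
      simp_rw [← ENNReal.ofReal_mul (hA.weight_nonneg _)]
      rw [← ENNReal.ofReal_sum_of_nonneg fun a _ => mul_nonneg (hA.weight_nonneg a) (by positivity)]
      congr 1
      simp only [NNReal.coe_add, mul_add, Finset.sum_add_distrib, ← Finset.sum_mul,
        sum_arrivalWeight, one_mul, U, NNReal.coe_sum, NNReal.coe_mul, NNReal.coe_natCast,
        Finset.mul_sum]
      rw [Finset.sum_comm]
      congr 1
      refine Finset.sum_congr rfl fun i _ => ?_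
      rw [← sum_arrivalWeight_mul lam i, Finset.mul_sum]
      exact Finset.sum_congr rfl fun a _ => by ring
    have hEV : V s + ENNReal.ofReal (∑ i, (w i : ℝ) * lam i) ≤
        ∑' s', transition C φ ψ lam s s' * V s' + m := by
      have h1 : ∑' s', transition C φ ψ lam s s' * V s' + m
          = ∑' s', transition C φ ψ lam s s' * (V s' + m) := by
        simp_rw [mul_add]
        rw [ENNReal.tsum_add, ENNReal.tsum_mul_right, tsum_transition C φ ψ hA, one_mul]
      rw [h1, tsum_transition_mul C φ ψ lam s fun s' => V s' + m, ← hU,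
        ← sum_lintegral_arrivals C φ lam s]
      gcongr with a _ y _ ue ur
      exact hnext a y ue ur
    refine (ENNReal.add_le_add_iff_right (by simp : (m : ℝ≥0∞) ≠ ∞)).1 (le_trans ?_ hEV)
    rw [add_assoc, ← ENNReal.ofReal_coe_nnreal (p := m), ← ENNReal.ofReal_add
      (by linarith) m.coe_nonneg, sub_add_cancel]

theorem mem_scheduleHull {d : Fin N → ℕ} (hd : d ∈ Sched) :
    (fun i => (d i : ℝ)) ∈ scheduleHull Sched :=
  subset_convexHull ℝ _ ⟨d, hd, rfl⟩

/-- A nonnegative vector outside the hull is separated from the schedules by nonnegative weights. -/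
theorem exists_weights_of_notMem_scheduleHull (hS : IsScheduleSet Sched) {lam : Fin N → ℝ}
    (h0 : ∀ i, 0 ≤ lam i) (h : lam ∉ scheduleHull Sched) :
    ∃ (w : Fin N → ℝ≥0) (m : ℝ≥0), (∀ d ∈ Sched, ∑ i, w i * (d i : ℝ≥0) ≤ m) ∧
      (m : ℝ) < ∑ i, (w i : ℝ) * lam i := by
  classical
  have hfin : ((fun (d : Fin N → ℕ) (i : Fin N) => (d i : ℝ)) ''
    (Sched : Set (Fin N → ℕ))).Finite := (Finset.finite_toSet _).image _
  obtain ⟨f, u, hu, hlt⟩ := geometric_hahn_banach_closed_point (convex_convexHull ℝ _)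
    (hfin.isClosed_convexHull ℝ) h
  let c : Fin N → ℝ := fun i => f (Pi.single i 1)
  have hf : ∀ x : Fin N → ℝ, f x = ∑ i, x i * c i := fun x => by
    conv_lhs => rw [pi_eq_sum_univ' x]
    simp [map_sum, c, Pi.single]
  have hu0 : 0 ≤ u := by
    obtain ⟨d, _, _, hd, _⟩ := hS.two_maximal
    have := hu _ (mem_scheduleHull (hS.monotone d hd.1 0 zero_le))
    simpa [hf] using this.le
  refine ⟨fun i => (c i).toNNReal, u.toNNReal, fun d hd => ?_, ?_⟩
  -- Coordinates with a nonpositive coefficient are deleted from the schedule, which monotonicity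
  -- permits. Thus f may be replaced by its positive part on schedules, and on `lam` this only
  -- increases the value.
  · have hd' := hu _ (mem_scheduleHull (hS.monotone d hd (fun i => if 0 < c i then d i else 0)
      fun i => by dsimp only; split_ifs <;> simp))
    rw [← NNReal.coe_le_coe, Real.coe_toNNReal u hu0]
    refine le_trans (le_of_eq ?_) hd'.le
    rw [hf]
    push_cast
    refine Finset.sum_congr rfl fun i _ => ?_
    split_ifs with hc
    · rw [Real.coe_toNNReal _ hc.le, mul_comm]
    · rw [Real.toNNReal_of_nonpos (not_lt.1 hc)]
      simp
  · rw [Real.coe_toNNReal u hu0]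
    refine hlt.trans_le ?_
    rw [hf]
    refine Finset.sum_le_sum fun i _ => ?_
    rw [mul_comm]
    exact mul_le_mul_of_nonneg_right (Real.le_coe_toNNReal _) (h0 i)

theorem IsScheduleSet.two_le (hS : IsScheduleSet Sched) : 2 ≤ N := by
  obtain ⟨d₁, d₂, hne, h1, h2⟩ := hS.two_maximal
  by_contra! h
  have : N = 0 ∨ N = 1 := by omega
  rcases this with rfl | rfl
  · exact hne (Subsingleton.elim _ _)
  · have hle : ∀ d d' : Fin 1 → ℕ, d 0 ≤ d' 0 → d ≤ d' := fun d d' h i => by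
      rwa [Subsingleton.elim i 0]
    rcases le_total (d₁ 0) (d₂ 0) with h | h
    · exact hne (h1.eq_of_le h2.1 (hle _ _ h))
    · exact hne (h2.eq_of_le h1.1 (hle _ _ h)).symm

theorem zero_mem_scheduleHull (hS : IsScheduleSet Sched) :
    (0 : Fin N → ℝ) ∈ scheduleHull Sched := by
  obtain ⟨d, _, _, hd, _⟩ := hS.two_maximal
  convert mem_scheduleHull (hS.monotone d hd.1 0 zero_le) using 1
  ext i
  simp

theorem exists_pos_const_mem_scheduleHull (hS : IsScheduleSet Sched) :
    ∃ x : ℝ, 0 < x ∧ (fun _ => x) ∈ scheduleHull Sched := by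
  obtain ⟨c, hc, hcS⟩ := hS.nondegenerate
  have hN : (0 : ℝ) < N := by exact_mod_cast (by linarith [hS.two_le] : 0 < N)
  refine ⟨(N : ℝ)⁻¹ * c, by positivity, ?_⟩
  have := (convex_convexHull ℝ _ : Convex ℝ (scheduleHull Sched)).sum_mem
    (t := Finset.univ) (w := fun _ : Fin N => (N : ℝ)⁻¹) (fun _ _ => by positivity)
    (by simp [hN.ne']) fun i _ => mem_scheduleHull (hcS i)
  refine (congrArg (· ∈ scheduleHull Sched) (funext fun j => ?_)).mp this
  simp only [Finset.sum_apply, Pi.smul_apply, smul_eq_mul, ← Finset.mul_sum]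
  simp [Pi.single_apply]

/-- The diagonal leaves the compact hull at some σ < 1. For ρ > 1 and σ < τ < min(1, ρσ), the rates
(τ,…,τ) lie in ρΛ, since τ/ρ < σ, but outside the hull. -/
theorem pairCapacityFactor_le_one [Countable X] [Fintype Y] (hS : IsScheduleSet Sched)
    (h1 : (fun _ => (1 : ℝ)) ∉ scheduleHull Sched) (C : Channel X Y)
    (φ : EncodingPolicy N X k) (ψ : AllocationPolicy Sched Y v) :
    pairCapacityFactor C φ ψ ≤ 1 := by
  refine iSup₂_le fun ρ hρ => ?_
  by_contra! hρ1
  have hρ1 : (1 : ℝ) < ρ := by exact_mod_cast hρ1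
  have hconv : Convex ℝ (scheduleHull Sched) := convex_convexHull ℝ _
  have hfin : ((fun (d : Fin N → ℕ) (i : Fin N) => (d i : ℝ)) ''
    (Sched : Set (Fin N → ℕ))).Finite := (Finset.finite_toSet _).image _
  let T : Set ℝ := {x | 0 ≤ x ∧ x ≤ 1 ∧ (fun _ => x) ∈ scheduleHull Sched}
  have hscale : ∀ x : ℝ, 0 < x → (fun _ => x) ∈ scheduleHull Sched → ∀ y, 0 ≤ y → y ≤ x →
      (fun _ => y) ∈ scheduleHull Sched := by
    intro x hx hxs y hy hyx
    have := hconv.smul_mem_of_zero_mem (zero_mem_scheduleHull hS) hxs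
      (t := y / x) ⟨by positivity, by rw [div_le_one hx]; exact hyx⟩
    convert this using 1
    ext i
    simp [hx.ne']
  have hT1 : ∀ x : ℝ, 0 ≤ x → (fun _ => x) ∈ scheduleHull Sched → x < 1 := by
    intro x _ hxs
    by_contra! h
    exact h1 (hscale x (by linarith) hxs 1 (by norm_num) h)
  have hTc : IsCompact T := by
    have : T = Set.Icc 0 1 ∩ (fun x : ℝ => fun _ : Fin N => x) ⁻¹' scheduleHull Sched := by
      ext x
      simp [T, and_assoc]
    rw [this]
    exact isCompact_Icc.inter_right ((hfin.isClosed_convexHull ℝ).preimage (by fun_prop))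
  obtain ⟨x₀, hx₀, hx₀S⟩ := exists_pos_const_mem_scheduleHull hS
  obtain ⟨σ, ⟨hσ0, -, hσS⟩, hσmax⟩ :=
    hTc.exists_isGreatest ⟨x₀, hx₀.le, (hT1 x₀ hx₀.le hx₀S).le, hx₀S⟩
  have hσpos : 0 < σ := hx₀.trans_le (hσmax ⟨hx₀.le, (hT1 x₀ hx₀.le hx₀S).le, hx₀S⟩)
  obtain ⟨τ, hτσ, hτ⟩ : ∃ τ, σ < τ ∧ τ < min 1 (ρ * σ) :=
    exists_between (lt_min (hT1 σ hσ0 hσS) (by nlinarith))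
  obtain ⟨hτ1, hτρ⟩ := lt_min_iff.1 hτ
  have hA : IsArrivalRate fun _ : Fin N => τ := fun _ => ⟨by linarith, hτ1⟩
  obtain ⟨w, m, hw, hlt⟩ := exists_weights_of_notMem_scheduleHull hS (lam := fun _ => τ)
    (fun _ => by linarith) fun h => absurd (hσmax ⟨by linarith, hτ1.le, h⟩) (not_le.2 hτσ)
  refine notMem_capacityRegion_of_weights C φ ψ w m hw hlt (hρ _ ?_ hA)
  refine ⟨fun _ => τ / ρ, ⟨fun _ => div_nonneg (by linarith) ρ.2, fun _ => σ, hσS, fun _ => ?_⟩, ?_⟩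
  · rw [div_lt_iff₀ (by linarith)]
    linarith
  · ext i
    simp only [Pi.smul_apply, smul_eq_mul]
    field_simp

end SPII

/-! ### Policies that estimate the arrival rates with urns -/

namespace SPII

/-- A distribution on a finite type is the law of a function of a uniform variable on `(0, 1)`. -/
theorem exists_sampler {Ω : Type*} [Fintype Ω] (w : Ω → ℝ) (hw : ∀ ω, 0 ≤ w ω)
    (hsum : ∑ ω, w ω = 1) : ∃ ξ : ℝ → Ω, (∀ ω, MeasurableSet {u | ξ u = ω}) ∧
      ∀ g : Ω → ℝ≥0∞, ∫⁻ u in Set.Ioo (0 : ℝ) 1, g (ξ u) = ∑ ω, ENNReal.ofReal (w ω) * g ω := by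
  let _ : MeasurableSpace Ω := ⊤
  have : DiscreteMeasurableSpace Ω := ⟨fun _ => trivial⟩
  have : Nonempty Ω := by
    by_contra h
    rw [not_nonempty_iff] at h
    simp at hsum
  let μ : Measure Ω := ∑ ω, ENNReal.ofReal (w ω) • Measure.dirac ω
  have hμ : IsProbabilityMeasure μ := ⟨by
    simp only [μ, Measure.coe_finsetSum, Finset.sum_apply, Measure.smul_apply,
      MeasureTheory.measure_univ, smul_eq_mul, mul_one]
    rw [← ENNReal.ofReal_sum_of_nonneg fun ω _ => hw ω, hsum, ENNReal.ofReal_one]⟩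
  obtain ⟨f, hf, hmap⟩ := μ.exists_measurable_map_eq
  have hξ : Measurable fun u : ℝ => f (Set.projIcc 0 1 zero_le_one u) :=
    hf.comp continuous_projIcc.measurable
  refine ⟨fun u => f (Set.projIcc 0 1 zero_le_one u), fun ω => hξ (measurableSet_singleton ω),
    fun g => ?_⟩
  rw [Measure.restrict_congr_set Ioo_ae_eq_Icc,
    ← lintegral_subtype_comap measurableSet_Icc fun u => g (f (Set.projIcc 0 1 zero_le_one u))]
  have h1 : ∫⁻ u : unitInterval, g (f u) = ∫⁻ ω, g ω ∂μ := by
    rw [← hmap, lintegral_map (Measurable.of_discrete) hf]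
  simp only [Set.projIcc_val]
  refine h1.trans ?_
  simp [μ, lintegral_smul_measure]

/-- One step of an urn with `L + 1` balls of which `z` are marked: the drawn ball `κ` gets marked
if `b` holds and unmarked otherwise. -/
def urnStep {L : ℕ} (b : Bool) (z : Fin (L + 2)) (κ : Fin (L + 1)) : Fin (L + 2) :=
  if b then (if h : z.val ≤ κ.val then ⟨z + 1, by omega⟩ else z)
  else (if κ.val < z.val then ⟨z - 1, by omega⟩ else z)

theorem sum_range_ite_lt (M z : ℕ) (hz : z ≤ M) (A B : ℝ) :
    ∑ κ ∈ Finset.range M, (if κ < z then A else B) = z * A + (M - z) * B := by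
  rw [Finset.sum_ite]
  have h1 : (Finset.range M).filter (· < z) = Finset.range z := by ext; simp; omega
  have h2 : (Finset.range M).filter (fun x => ¬ x < z) = Finset.Ico z M := by ext; simp; omega
  rw [h1, h2]
  simp [Nat.cast_sub hz]

theorem sum_fin_ite_lt {L : ℕ} (z : Fin (L + 2)) (A B : ℝ) :
    ∑ κ : Fin (L + 1), (if κ.val < z.val then A else B) = z.val * A + ((L + 1 : ℝ) - z.val) * B := by
  rw [Fin.sum_univ_eq_sum_range (fun κ => if κ < z.val then A else B) (L + 1),
    sum_range_ite_lt _ _ (by omega)]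
  push_cast
  ring

/-- The mean square distance from `x` after a step of the urn. -/
theorem sum_urnStep_sq_le {L : ℕ} (b : Bool) (z : Fin (L + 2)) (x : ℝ) :
    ∑ κ : Fin (L + 1), (1 / (L + 1 : ℝ)) * (((urnStep b z κ).val : ℝ) - x) ^ 2 ≤
      ((z.val : ℝ) - x) ^ 2 + 2 * ((z.val : ℝ) - x) * (b.toNat - z.val / (L + 1 : ℝ)) + 1 := by
  have hL : (0 : ℝ) < L + 1 := by positivity
  have hz : (z.val : ℝ) ≤ L + 1 := by exact_mod_cast (by omega : z.val ≤ L + 1)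
  have hz0 : (0 : ℝ) ≤ z.val := by positivity
  -- The balls with index below z count as marked. The increment of z has mean b - z/(L+1) and
  -- square at most 1.
  rw [← Finset.mul_sum]
  cases b with
  | true =>
    have h : ∀ κ : Fin (L + 1), (((urnStep true z κ).val : ℝ) - x) ^ 2 =
        if κ.val < z.val then ((z.val : ℝ) - x) ^ 2 else ((z.val : ℝ) + 1 - x) ^ 2 := by
      intro κ
      unfold urnStep
      by_cases h : z.val ≤ κ.val
      · simp [h]
      · simp [h, not_le.1 h]
    simp_rw [h]
    rw [sum_fin_ite_lt]
    have h2 : 0 ≤ (z.val : ℝ) / (L + 1) := by positivity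
    calc _ = ((z.val : ℝ) - x) ^ 2 + 2 * ((z.val : ℝ) - x) * ((true.toNat : ℕ) - z.val / (L + 1 : ℝ))
          + (1 - z.val / (L + 1)) := by
            simp only [Bool.toNat_true, Nat.cast_one]
            field_simp
            ring
      _ ≤ _ := by linarith
  | false =>
    have h : ∀ κ : Fin (L + 1), (((urnStep false z κ).val : ℝ) - x) ^ 2 =
        if κ.val < z.val then ((z.val : ℝ) - 1 - x) ^ 2 else ((z.val : ℝ) - x) ^ 2 := by
      intro κ
      unfold urnStep
      by_cases h : κ.val < z.val
      · simp only [Bool.false_eq_true, if_false, h, if_true]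
        rw [Nat.cast_sub (by omega)]
        simp
      · simp [h]
    simp_rw [h]
    rw [sum_fin_ite_lt]
    have h2 : (z.val : ℝ) / (L + 1) ≤ 1 := by rw [div_le_one hL]; exact hz
    calc _ = ((z.val : ℝ) - x) ^ 2 + 2 * ((z.val : ℝ) - x) * ((false.toNat : ℕ) - z.val / (L + 1 : ℝ))
          + z.val / (L + 1) := by
            simp only [Bool.toNat_false, Nat.cast_zero]
            field_simp
            ring
      _ ≤ _ := by linarith

/-- The data of a policy pair: at each step the encoder reports whether there was an arrival to the
queue that is due, with the signals `one` and `zero`. The receiver keeps one urn for each queue,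
updates the urns in turn according to the messages, and draws the schedule from a distribution that
depends on the urns. -/
structure UrnScheme {n : ℕ} (Sched : Finset (Fin (n + 2) → ℕ)) (X Y : Type*) (L k v : ℕ) where
  zero : X
  one : X
  isOne : Y → Bool
  weight : (Fin (n + 2) → Fin (L + 2)) → Sched → ℝ
  weight_pos : ∀ z d, 0 < weight z d
  sum_weight : ∀ z, ∑ d, weight z d = 1
  sample : (Fin (n + 2) → Fin (L + 2)) → ℝ → Sched × Fin (L + 1)
  measurable_sample : ∀ z ω, MeasurableSet {u | sample z u = ω}
  lintegral_sample : ∀ z (g : Sched × Fin (L + 1) → ℝ≥0∞),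
    ∫⁻ u in Set.Ioo (0 : ℝ) 1, g (sample z u) =
      ∑ ω, ENNReal.ofReal (weight z ω.1 * (1 / (L + 1 : ℝ))) * g ω
  encPhase : Fin (n + 2) → Memory k
  decPhase : Memory k → Fin (n + 2)
  dec_encPhase : ∀ c, decPhase (encPhase c) = c
  encUrns : Fin (n + 2) × (Fin (n + 2) → Fin (L + 2)) → Memory v
  decUrns : Memory v → Fin (n + 2) × (Fin (n + 2) → Fin (L + 2))
  dec_encUrns : ∀ m, decUrns (encUrns m) = m

theorem exists_memory_encoding {M : Type*} [Fintype M] [Nonempty M] {k : ℕ}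
    (h : Fintype.card M ≤ 2 ^ k) : ∃ (e : M → Memory k) (f : Memory k → M), ∀ m, f (e m) = m := by
  obtain ⟨e⟩ := Function.Embedding.nonempty_of_card_le (α := M) (β := Memory k) (by simpa using h)
  exact ⟨e, Function.invFun e, Function.leftInverse_invFun e.injective⟩

/-- Schedule and ball are sampled jointly, as both policy functions see the same uniform variable;
the product weights make them independent. -/
theorem exists_urnScheme {n : ℕ} {Sched : Finset (Fin (n + 2) → ℕ)} {X Y : Type*} {L k v : ℕ}
    (zero one : X) (isOne : Y → Bool) (weight : (Fin (n + 2) → Fin (L + 2)) → Sched → ℝ)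
    (weight_pos : ∀ z d, 0 < weight z d) (sum_weight : ∀ z, ∑ d, weight z d = 1)
    (hk : n + 2 ≤ 2 ^ k) (hv : (n + 2) * (L + 2) ^ (n + 2) ≤ 2 ^ v) :
    ∃ D : UrnScheme Sched X Y L k v, D.zero = zero ∧ D.one = one ∧ D.isOne = isOne ∧
      D.weight = weight := by
  have hs := fun z => exists_sampler (Ω := Sched × Fin (L + 1))
    (fun ω => weight z ω.1 * (1 / (L + 1 : ℝ)))
    (fun ω => mul_nonneg (weight_pos z _).le (by positivity)) (by
      rw [Fintype.sum_prod_type]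
      simp only [Finset.sum_const, Finset.card_univ, Fintype.card_fin, nsmul_eq_mul,
        ← Finset.mul_sum, ← Finset.sum_mul, sum_weight]
      push_cast
      field_simp)
  choose ξ hξ hξ' using hs
  obtain ⟨e, f, hef⟩ := exists_memory_encoding (M := Fin (n + 2)) (k := k) (by simpa using hk)
  obtain ⟨e', f', hef'⟩ := exists_memory_encoding
    (M := Fin (n + 2) × (Fin (n + 2) → Fin (L + 2))) (k := v) (by simpa using hv)
  exact ⟨⟨zero, one, isOne, weight, weight_pos, sum_weight, ξ, hξ, hξ', e, f, hef, e', f', hef'⟩,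
    rfl, rfl, rfl, rfl⟩

namespace UrnScheme

variable {n : ℕ} {Sched : Finset (Fin (n + 2) → ℕ)} {X Y : Type*} {L k v : ℕ}
  (D : UrnScheme Sched X Y L k v)

theorem measurableSet_sample (z : Fin (n + 2) → Fin (L + 2)) (p : Sched × Fin (L + 1) → Prop) :
    MeasurableSet {u | p (D.sample z u)} := by
  have : {u | p (D.sample z u)} = ⋃ ω : {ω // p ω}, {u | D.sample z u = ω} := by
    ext u
    simp
  rw [this]
  exact MeasurableSet.iUnion fun ω => D.measurable_sample z ω

/-- The signal for an arrival (or none). -/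
def sig (b : Bool) : X := if b then D.one else D.zero

/-- The urns after an update of the one that is due. -/
def urnsStep (y : Y) (m : Fin (n + 2) × (Fin (n + 2) → Fin (L + 2))) (κ : Fin (L + 1)) :
    Fin (n + 2) × (Fin (n + 2) → Fin (L + 2)) :=
  (m.1 + 1, Function.update m.2 m.1 (urnStep (D.isOne y) (m.2 m.1) κ))

/-- The encoding policy of the scheme. -/
def encoder : EncodingPolicy (n + 2) X k where
  act _ a m _ := (D.sig (a (D.decPhase m)), D.encPhase (D.decPhase m + 1))
  measurable_act _ _ _ _ := MeasurableSet.const _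
  initSignal := D.zero
  initMem := D.encPhase 1

/-- The allocation policy of the scheme. -/
def allocator : AllocationPolicy Sched Y v where
  alloc _ m u := (D.sample (D.decUrns m).2 u).1.1
  alloc_mem _ _ _ := Subtype.property _
  measurable_alloc _ _ d := D.measurableSet_sample _ fun ω => ω.1.1 = d
  update y m u := D.encUrns (D.urnsStep y (D.decUrns m) (D.sample (D.decUrns m).2 u).2)
  measurable_update y m m' :=
    D.measurableSet_sample _ fun ω => D.encUrns (D.urnsStep y (D.decUrns m) ω.2) = m'
  initMem := D.encUrns (0, 0)

/-- The state after one step, in terms of the arrivals, the message, the schedule and the ball. -/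
def next (s : State (n + 2) X Y k v) (a : Fin (n + 2) → Bool) (y : Y) (d : Sched)
    (κ : Fin (L + 1)) : State (n + 2) X Y k v where
  queue := fun i => (s.queue i - d.1 i) + (a i).toNat
  arrivals := a
  encMem := D.encPhase (D.decPhase s.encMem + 1)
  signal := D.sig (s.arrivals (D.decPhase s.encMem))
  recMem := D.encUrns (D.urnsStep s.message (D.decUrns s.recMem) κ)
  message := y

variable [Fintype Y] (C : Channel X Y)

/-- The probability of one step. -/
noncomputable def stepWeight (lam : Fin (n + 2) → ℝ) (s : State (n + 2) X Y k v)
    (a : Fin (n + 2) → Bool) (y : Y) (d : Sched) : ℝ :=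
  arrivalWeight lam a * C.prob (D.sig (s.arrivals (D.decPhase s.encMem))) y *
    D.weight (D.decUrns s.recMem).2 d * (1 / (L + 1 : ℝ))

/-- The expectation over one step. -/
noncomputable def expect (lam : Fin (n + 2) → ℝ) (s : State (n + 2) X Y k v)
    (f : (Fin (n + 2) → Bool) → Y → Sched → Fin (L + 1) → ℝ) : ℝ :=
  ∑ a, ∑ y, ∑ d, ∑ κ, D.stepWeight C lam s a y d * f a y d κ

variable {C} {lam : Fin (n + 2) → ℝ}

theorem stepWeight_nonneg (h : IsArrivalRate lam) (s : State (n + 2) X Y k v)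
    (a : Fin (n + 2) → Bool) (y : Y) (d : Sched) : 0 ≤ D.stepWeight C lam s a y d :=
  mul_nonneg (mul_nonneg (mul_nonneg (h.weight_nonneg a) (C.nonneg _ _)) (D.weight_pos _ _).le)
    (by positivity)

theorem tsum_transition_mul [Countable X] (h : IsArrivalRate lam) (s : State (n + 2) X Y k v)
    (g : State (n + 2) X Y k v → ℝ≥0∞) :
    ∑' s', transition C D.encoder D.allocator lam s s' * g s' =
      ∑ a, ∑ y, ∑ d, ∑ κ, ENNReal.ofReal (D.stepWeight C lam s a y d) * g (D.next s a y d κ) := by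
  rw [SPII.tsum_transition_mul]
  refine Finset.sum_congr rfl fun a _ => Finset.sum_congr rfl fun y _ => ?_
  have h1 : ∀ ue ur, nextState D.encoder D.allocator s a y ue ur =
      D.next s a y (D.sample (D.decUrns s.recMem).2 ur).1 (D.sample (D.decUrns s.recMem).2 ur).2 :=
    fun _ _ => rfl
  simp_rw [h1]
  have h2 : ∀ ue, (D.encoder.act s.queue s.arrivals s.encMem ue).1 =
    D.sig (s.arrivals (D.decPhase s.encMem)) := fun _ => rfl
  simp_rw [h2]
  rw [D.lintegral_sample _ fun ω => arrivalProb lam a *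
    ENNReal.ofReal (C.prob (D.sig (s.arrivals (D.decPhase s.encMem))) y) *
      g (D.next s a y ω.1 ω.2)]
  rw [lintegral_const, Measure.restrict_apply MeasurableSet.univ, Set.univ_inter, Real.volume_Ioo,
    sub_zero, ENNReal.ofReal_one, mul_one, Fintype.sum_prod_type]
  refine Finset.sum_congr rfl fun d _ => Finset.sum_congr rfl fun κ _ => ?_
  have hw := (D.weight_pos (D.decUrns s.recMem).2 d).le
  rw [arrivalProb_eq h, stepWeight, mul_assoc _ (D.weight _ _) _,
    ENNReal.ofReal_mul (mul_nonneg (h.weight_nonneg a) (C.nonneg _ _)),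
    ENNReal.ofReal_mul (h.weight_nonneg a)]
  ring

theorem tsum_transition_mul_ofReal [Countable X] (h : IsArrivalRate lam)
    (s : State (n + 2) X Y k v) (G : State (n + 2) X Y k v → ℝ) (hG : ∀ s, 0 ≤ G s) :
    ∑' s', transition C D.encoder D.allocator lam s s' * ENNReal.ofReal (G s') =
      ENNReal.ofReal (D.expect C lam s fun a y d κ => G (D.next s a y d κ)) := by
  have h0 := D.stepWeight_nonneg (C := C) h s
  rw [D.tsum_transition_mul h, expect]
  rw [ENNReal.ofReal_sum_of_nonneg fun a _ => Finset.sum_nonneg fun y _ => Finset.sum_nonneg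
    fun d _ => Finset.sum_nonneg fun κ _ => mul_nonneg (h0 a y d) (hG _)]
  refine Finset.sum_congr rfl fun a _ => ?_
  rw [ENNReal.ofReal_sum_of_nonneg fun y _ => Finset.sum_nonneg
    fun d _ => Finset.sum_nonneg fun κ _ => mul_nonneg (h0 a y d) (hG _)]
  refine Finset.sum_congr rfl fun y _ => ?_
  rw [ENNReal.ofReal_sum_of_nonneg
    fun d _ => Finset.sum_nonneg fun κ _ => mul_nonneg (h0 a y d) (hG _)]
  refine Finset.sum_congr rfl fun d _ => ?_
  rw [ENNReal.ofReal_sum_of_nonneg fun κ _ => mul_nonneg (h0 a y d) (hG _)]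
  exact Finset.sum_congr rfl fun κ _ => (ENNReal.ofReal_mul (h0 a y d)).symm

/-! ### Expectations over one step -/

theorem expect_add (s : State (n + 2) X Y k v)
    (f g : (Fin (n + 2) → Bool) → Y → Sched → Fin (L + 1) → ℝ) :
    D.expect C lam s (fun a y d κ => f a y d κ + g a y d κ) =
      D.expect C lam s f + D.expect C lam s g := by
  simp only [expect, mul_add, Finset.sum_add_distrib]

theorem expect_const_mul (s : State (n + 2) X Y k v) (c : ℝ)
    (f : (Fin (n + 2) → Bool) → Y → Sched → Fin (L + 1) → ℝ) :
    D.expect C lam s (fun a y d κ => c * f a y d κ) = c * D.expect C lam s f := by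
  simp only [expect, Finset.mul_sum]
  exact Finset.sum_congr rfl fun _ _ => Finset.sum_congr rfl fun _ _ => Finset.sum_congr rfl
    fun _ _ => Finset.sum_congr rfl fun _ _ => by ring

theorem expect_mono (h : IsArrivalRate lam) (s : State (n + 2) X Y k v)
    {f g : (Fin (n + 2) → Bool) → Y → Sched → Fin (L + 1) → ℝ}
    (hfg : ∀ a y d κ, f a y d κ ≤ g a y d κ) : D.expect C lam s f ≤ D.expect C lam s g :=
  Finset.sum_le_sum fun a _ => Finset.sum_le_sum fun y _ => Finset.sum_le_sum fun d _ =>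
    Finset.sum_le_sum fun κ _ =>
      mul_le_mul_of_nonneg_left (hfg a y d κ) (D.stepWeight_nonneg h s a y d)

/-- The signal is a function of the current state, so given this state the arrivals, message,
schedule and ball are independent. -/
theorem expect_mul (s : State (n + 2) X Y k v) (fa : (Fin (n + 2) → Bool) → ℝ) (fy : Y → ℝ)
    (fd : Sched → ℝ) (fκ : Fin (L + 1) → ℝ) :
    D.expect C lam s (fun a y d κ => fa a * fy y * fd d * fκ κ) =
      (∑ a, arrivalWeight lam a * fa a) *
      (∑ y, C.prob (D.sig (s.arrivals (D.decPhase s.encMem))) y * fy y) *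
      (∑ d, D.weight (D.decUrns s.recMem).2 d * fd d) * (∑ κ, (1 / (L + 1 : ℝ)) * fκ κ) := by
  rw [Finset.sum_mul_sum, Finset.sum_mul, Finset.sum_mul]
  refine Finset.sum_congr rfl fun a _ => ?_
  rw [Finset.sum_mul, Finset.sum_mul]
  refine Finset.sum_congr rfl fun y _ => ?_
  rw [mul_assoc, Finset.sum_mul_sum, Finset.mul_sum]
  refine Finset.sum_congr rfl fun d _ => ?_
  rw [Finset.mul_sum]
  refine Finset.sum_congr rfl fun κ _ => ?_
  rw [stepWeight]
  ring

theorem sum_ball : ∑ _κ : Fin (L + 1), (1 / (L + 1 : ℝ)) = 1 := by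
  rw [Finset.sum_const, Finset.card_univ, Fintype.card_fin, nsmul_eq_mul]
  push_cast
  field_simp

theorem expect_const (s : State (n + 2) X Y k v) (c : ℝ) :
    D.expect C lam s (fun _ _ _ _ => c) = c := by
  have := D.expect_mul (C := C) (lam := lam) s (fun _ => c) (fun _ => 1) (fun _ => 1) (fun _ => 1)
  simpa only [sum_ball, D.sum_weight, C.sum_eq_one, ← Finset.sum_mul, sum_arrivalWeight, mul_one, one_mul] using this

theorem expect_schedule (s : State (n + 2) X Y k v) (f : Sched → ℝ) :
    D.expect C lam s (fun _ _ d _ => f d) = ∑ d, D.weight (D.decUrns s.recMem).2 d * f d := by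
  have := D.expect_mul (C := C) (lam := lam) s (fun _ => 1) (fun _ => 1) f (fun _ => 1)
  simpa only [sum_ball, C.sum_eq_one, sum_arrivalWeight, mul_one, one_mul] using this

theorem expect_message (s : State (n + 2) X Y k v) (f : Y → ℝ) :
    D.expect C lam s (fun _ y _ _ => f y) =
      ∑ y, C.prob (D.sig (s.arrivals (D.decPhase s.encMem))) y * f y := by
  have := D.expect_mul (C := C) (lam := lam) s (fun _ => 1) f (fun _ => 1) (fun _ => 1)
  simpa only [sum_ball, D.sum_weight, sum_arrivalWeight, mul_one, one_mul] using this

theorem expect_arrivals_mul_ball (s : State (n + 2) X Y k v) (f : (Fin (n + 2) → Bool) → ℝ)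
    (g : Fin (L + 1) → ℝ) : D.expect C lam s (fun a _ _ κ => f a * g κ) =
      (∑ a, arrivalWeight lam a * f a) * ∑ κ, (1 / (L + 1 : ℝ)) * g κ := by
  have := D.expect_mul (C := C) (lam := lam) s f (fun _ => 1) (fun _ => 1) g
  simpa only [D.sum_weight, C.sum_eq_one, mul_one, one_mul] using this

theorem expect_ball (s : State (n + 2) X Y k v) (g : Fin (L + 1) → ℝ) :
    D.expect C lam s (fun _ _ _ κ => g κ) = ∑ κ, (1 / (L + 1 : ℝ)) * g κ := by
  have := D.expect_arrivals_mul_ball (C := C) (lam := lam) s (fun _ => 1) g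
  simpa only [sum_arrivalWeight, mul_one, one_mul] using this

theorem expect_arrivals (s : State (n + 2) X Y k v) (f : (Fin (n + 2) → Bool) → ℝ) :
    D.expect C lam s (fun a _ _ _ => f a) = ∑ a, arrivalWeight lam a * f a := by
  have := D.expect_arrivals_mul_ball (C := C) (lam := lam) s f (fun _ => 1)
  simpa only [sum_ball, mul_one, one_mul] using this

end UrnScheme

end SPII

/-! ### Drift of the urn scheme -/

namespace SPII

namespace UrnScheme

variable {n : ℕ} {Sched : Finset (Fin (n + 2) → ℕ)} {X Y : Type*} {L k v : ℕ}
  (D : UrnScheme Sched X Y L k v) [Fintype Y] {C : Channel X Y} {lam : Fin (n + 2) → ℝ}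

theorem expect_sum {ι : Type*} (t : Finset ι) (s : State (n + 2) X Y k v)
    (f : ι → (Fin (n + 2) → Bool) → Y → Sched → Fin (L + 1) → ℝ) :
    D.expect C lam s (fun a y d κ => ∑ i ∈ t, f i a y d κ) = ∑ i ∈ t, D.expect C lam s (f i) := by
  classical
  induction t using Finset.induction_on with
  | empty => simpa using D.expect_const s 0
  | insert i t hi ih =>
    simp only [Finset.sum_insert hi, D.expect_add, ih]

/-- The deviation of an urn from its mean. -/
def dev (p : Fin (n + 2) → ℝ) (m : Fin (n + 2) × (Fin (n + 2) → Fin (L + 2)))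
    (j : Fin (n + 2)) : ℝ := (m.2 j).val - (L + 1 : ℝ) * p j

/-- The weight of an urn that is due in `i` steps. -/
noncomputable def dueWeight (n L : ℕ) (θ i : ℝ) : ℝ := θ * ((n + 2) * (L + 1) / 2 + i)

/-- A function that compensates the errors of the estimates. -/
noncomputable def potential (p : Fin (n + 2) → ℝ) (lam : Fin (n + 2) → ℝ) (γ θ : ℝ)
    (m : Fin (n + 2) × (Fin (n + 2) → Fin (L + 2))) (a : Fin (n + 2) → Bool) (y : Y) : ℝ :=
  ∑ j, dueWeight n L θ (j - m.1).val * dev p m j ^ 2 +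
    dueWeight n L θ (n + 1) * (2 * dev p m m.1 * ((D.isOne y).toNat - p m.1) +
      2 * dev p m (m.1 + 1) * (γ * ((a (m.1 + 1)).toNat - lam (m.1 + 1))))

theorem val_sub_add_one {j r : Fin (n + 2)} (h : j ≠ r) :
    (((j - (r + 1)).val : ℕ) : ℝ) = (j - r).val - 1 := by
  have h0 : j - r ≠ 0 := sub_ne_zero.2 h
  have h1 : j - (r + 1) = (j - r) - 1 := by abel
  have h2 : 0 < (j - r).val := Nat.pos_of_ne_zero fun h => h0 (Fin.ext h)
  rw [h1, Fin.coe_sub_one, if_neg h0, Nat.cast_sub h2, Nat.cast_one]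

theorem val_sub_self_add_one (r : Fin (n + 2)) : (r - (r + 1)).val = n + 1 := by
  have h1 : r - (r + 1) = 0 - 1 := by abel
  rw [h1, Fin.coe_sub_one, if_pos rfl]

omit [Fintype Y] in
theorem dev_urnsStep_of_ne (p : Fin (n + 2) → ℝ) (y : Y)
    (m : Fin (n + 2) × (Fin (n + 2) → Fin (L + 2))) (κ : Fin (L + 1)) {j : Fin (n + 2)}
    (h : j ≠ m.1) : dev p (D.urnsStep y m κ) j = dev p m j := by
  simp [dev, urnsStep, h]

omit [Fintype Y] in
theorem dev_urnsStep_self (p : Fin (n + 2) → ℝ) (y : Y)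
    (m : Fin (n + 2) × (Fin (n + 2) → Fin (L + 2))) (κ : Fin (L + 1)) :
    dev p (D.urnsStep y m κ) m.1 =
      (urnStep (D.isOne y) (m.2 m.1) κ).val - (L + 1 : ℝ) * p m.1 := by
  simp [dev, urnsStep]

-- The cross terms of the potential replace the message for the urn that is due, and the pending
-- arrival for the next one, by their means. In a step the message term is absorbed by the urn
-- update, the arrival term is the conditional mean of the new message term, and the new arrival
-- term has mean zero. The right side is sorted by these sources of randomness. An urn that is not
-- due comes one step closer, so its weight drops by θ.
omit [Fintype Y] in
theorem potential_urnsStep (p : Fin (n + 2) → ℝ) (γ θ : ℝ)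
    (m : Fin (n + 2) × (Fin (n + 2) → Fin (L + 2))) (a : Fin (n + 2) → Bool) (y y' : Y)
    (κ : Fin (L + 1)) :
    D.potential p lam γ θ (D.urnsStep y m κ) a y' =
      (∑ j ∈ Finset.univ.erase m.1, (dueWeight n L θ (j - m.1).val - θ) * dev p m j ^ 2 +
      dueWeight n L θ (n + 1) *
        ((urnStep (D.isOne y) (m.2 m.1) κ).val - (L + 1 : ℝ) * p m.1) ^ 2) +
      (dueWeight n L θ (n + 1) * (2 * dev p m (m.1 + 1)) *
        ((D.isOne y').toNat - p (m.1 + 1)) +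
      ((a (m.1 + 1 + 1)).toNat - lam (m.1 + 1 + 1)) * (dueWeight n L θ (n + 1) * (2 * γ) *
        dev p (D.urnsStep y m κ) (m.1 + 1 + 1))) := by
  have h1 : (D.urnsStep y m κ).1 = m.1 + 1 := rfl
  have hne : m.1 + 1 ≠ m.1 := by simp
  rw [potential, h1, D.dev_urnsStep_of_ne p y m κ hne,
    ← Finset.add_sum_erase Finset.univ _ (Finset.mem_univ m.1), D.dev_urnsStep_self,
    val_sub_self_add_one]
  have h2 : ∑ j ∈ Finset.univ.erase m.1, dueWeight n L θ (j - (m.1 + 1)).val *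
        dev p (D.urnsStep y m κ) j ^ 2 =
      ∑ j ∈ Finset.univ.erase m.1, (dueWeight n L θ (j - m.1).val - θ) * dev p m j ^ 2 := by
    refine Finset.sum_congr rfl fun j hj => ?_
    have hj := Finset.ne_of_mem_erase hj
    rw [D.dev_urnsStep_of_ne p y m κ hj, val_sub_add_one hj]
    simp only [dueWeight]
    ring
  rw [h2]
  push_cast
  ring

theorem sum_prob_sig {α β : ℝ} (hα : ∑ y, C.prob D.zero y * (D.isOne y).toNat = α)
    (hβ : ∑ y, C.prob D.one y * (D.isOne y).toNat = β) (b : Bool) :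
    ∑ y, C.prob (D.sig b) y * (D.isOne y).toNat = α + (β - α) * b.toNat := by
  cases b <;> simp [sig, hα, hβ]

/-- The drift of the potential. -/
theorem expect_potential_le {α β θ : ℝ} (hθ : 0 ≤ θ)
    (hα : ∑ y, C.prob D.zero y * (D.isOne y).toNat = α)
    (hβ : ∑ y, C.prob D.one y * (D.isOne y).toNat = β) (s : State (n + 2) X Y k v)
    (hs : D.decPhase s.encMem = (D.decUrns s.recMem).1 + 1) (p : Fin (n + 2) → ℝ)
    (hp : ∀ j, p j = α + (β - α) * lam j) :
    D.expect C lam s (fun a y _ κ => D.potential p lam (β - α) θ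
        (D.urnsStep s.message (D.decUrns s.recMem) κ) a y) ≤
      D.potential p lam (β - α) θ (D.decUrns s.recMem) s.arrivals s.message -
        θ * ∑ j, dev p (D.decUrns s.recMem) j ^ 2 + dueWeight n L θ (n + 1) := by
  set m := D.decUrns s.recMem with hm
  have hw : 0 ≤ dueWeight n L θ (n + 1) := by unfold dueWeight; positivity
  have hurn := sum_urnStep_sq_le (D.isOne s.message) (m.2 m.1) ((L + 1 : ℝ) * p m.1)
  have hL : (0 : ℝ) < L + 1 := by positivity
  have hEm : D.expect C lam s (fun _ y _ _ => dueWeight n L θ (n + 1) * (2 * dev p m (m.1 + 1)) *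
      ((D.isOne y).toNat - p (m.1 + 1))) = dueWeight n L θ (n + 1) * (2 * dev p m (m.1 + 1)) *
        ((β - α) * ((s.arrivals (m.1 + 1)).toNat - lam (m.1 + 1))) := by
    rw [D.expect_const_mul, D.expect_message s fun y => ((D.isOne y).toNat : ℝ) - p (m.1 + 1)]
    simp only [mul_sub, Finset.sum_sub_distrib, ← Finset.sum_mul, C.sum_eq_one, one_mul,
      D.sum_prob_sig hα hβ, hs, hp]
    ring
  -- With two queues, `m.1 + 1 + 1` is `m.1`, and this deviation depends on the ball drawn; the ball
  -- is independent of the centred arrivals.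
  have hEa : D.expect C lam s (fun a _ _ κ => ((a (m.1 + 1 + 1)).toNat - lam (m.1 + 1 + 1)) *
      (dueWeight n L θ (n + 1) * (2 * (β - α)) *
        dev p (D.urnsStep s.message m κ) (m.1 + 1 + 1))) = 0 := by
    rw [D.expect_arrivals_mul_ball s
      (fun a => ((a (m.1 + 1 + 1)).toNat : ℝ) - lam (m.1 + 1 + 1))
      (fun κ => dueWeight n L θ (n + 1) * (2 * (β - α)) *
        dev p (D.urnsStep s.message m κ) (m.1 + 1 + 1))]
    simp only [mul_sub, Finset.sum_sub_distrib, ← Finset.sum_mul, sum_arrivalWeight,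
      sum_arrivalWeight_mul]
    ring
  have hEκ := D.expect_ball (C := C) (lam := lam) s
    fun κ => (((urnStep (D.isOne s.message) (m.2 m.1) κ).val : ℝ) - (L + 1 : ℝ) * p m.1) ^ 2
  simp_rw [D.potential_urnsStep]
  rw [D.expect_add, D.expect_add, D.expect_add, hEm, hEa, D.expect_const, D.expect_const_mul, hEκ]
  rw [potential, ← Finset.add_sum_erase Finset.univ _ (Finset.mem_univ m.1),
    ← Finset.add_sum_erase Finset.univ (fun j => dev p m j ^ 2) (Finset.mem_univ m.1)]
  simp only [sub_mul, Finset.sum_sub_distrib, ← Finset.mul_sum, sub_self]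
  have hstep := mul_le_mul_of_nonneg_left hurn hw
  rw [← Finset.mul_sum] at hstep
  have hdev : ((m.2 m.1).val : ℝ) - (L + 1) * p m.1 = dev p m m.1 := rfl
  have hz : ((m.2 m.1).val : ℝ) / (L + 1) = dev p m m.1 / (L + 1) + p m.1 := by
    rw [← hdev]
    field_simp
    ring
  rw [hdev, hz] at hstep
  -- The update contracts the square by 1 - 2/(L+1), while the weight rises from θK to θ(K+n+1).
  -- With K = (n+2)(L+1)/2 the product is below θ(K-1), so the urn that is due also loses θ dev².
  have hkey : dueWeight n L θ (n + 1) * (dev p m m.1 ^ 2 - 2 * dev p m m.1 * (dev p m m.1 / (L + 1)))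
      ≤ dueWeight n L θ 0 * dev p m m.1 ^ 2 - θ * dev p m m.1 ^ 2 := by
    have : dueWeight n L θ (n + 1) *
        (dev p m m.1 ^ 2 - 2 * dev p m m.1 * (dev p m m.1 / (L + 1))) =
        dueWeight n L θ 0 * dev p m m.1 ^ 2 - θ * dev p m m.1 ^ 2
          - θ * (2 * (n + 1) / (L + 1)) * dev p m m.1 ^ 2 := by
      simp only [dueWeight]
      field_simp
      ring
    rw [this]
    have : 0 ≤ θ * (2 * (n + 1) / (L + 1)) * dev p m m.1 ^ 2 := by positivity
    linarith
  simp only [Fin.val_zero, Nat.cast_zero]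
  linarith

theorem exists_abs_potential_le (p : Fin (n + 2) → ℝ) (γ θ : ℝ) :
    ∃ M, ∀ m a y, |D.potential p lam γ θ m a y| ≤ M := by
  obtain ⟨M, hM⟩ := (Set.finite_range fun x : (Fin (n + 2) × (Fin (n + 2) → Fin (L + 2))) ×
    (Fin (n + 2) → Bool) × Y => |D.potential p lam γ θ x.1 x.2.1 x.2.2|).bddAbove
  exact ⟨M, fun m a y => hM ⟨(m, a, y), rfl⟩⟩

theorem exists_schedule_le (Sched : Finset (Fin (n + 2) → ℕ)) :
    ∃ M : ℝ, ∀ (d : Sched) i, (d.1 i : ℝ) ≤ M := by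
  obtain ⟨M, hM⟩ :=
    (Set.finite_range fun x : Sched × Fin (n + 2) => (x.1.1 x.2 : ℝ)).bddAbove
  exact ⟨M, fun d i => hM ⟨(d, i), rfl⟩⟩

/-- If the mean schedule exceeds the arrival rates up to the error of the estimates, then there is a
quadratic Lyapunov function. -/
theorem exists_lyapunov {α β θ δ : ℝ} (hθ : 0 ≤ θ) (hδ : 0 ≤ δ) (hA : IsArrivalRate lam)
    (hα : ∑ y, C.prob D.zero y * (D.isOne y).toNat = α)
    (hβ : ∑ y, C.prob D.one y * (D.isOne y).toNat = β) (p : Fin (n + 2) → ℝ)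
    (hp : ∀ j, p j = α + (β - α) * lam j)
    (hrate : ∀ m i, lam i + 2 * δ ≤ ∑ d, D.weight m.2 d * (d.1 i : ℝ) + θ * ∑ j, dev p m j ^ 2)
    (hw : dueWeight n L θ (n + 1) ≤ δ) :
    ∃ (V : State (n + 2) X Y k v → ℝ) (b : ℝ), 0 ≤ b ∧ (∀ s, 0 ≤ V s) ∧
      ∀ s, D.decPhase s.encMem = (D.decUrns s.recMem).1 + 1 →
        D.expect C lam s (fun a y d κ => V (D.next s a y d κ)) ≤
          V s - 2 * δ * (∑ i, (s.queue i : ℝ)) + b := by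
  obtain ⟨M, hM⟩ := D.exists_abs_potential_le (lam := lam) p (β - α) θ
  obtain ⟨R, hR⟩ := exists_schedule_le Sched
  let h : State (n + 2) X Y k v → ℝ := fun s =>
    D.potential p lam (β - α) θ (D.decUrns s.recMem) s.arrivals s.message
  have hh : ∀ s, |h s| ≤ M := fun s => hM _ _ _
  -- B bounds the change of queue plus potential in one step: service R, one arrival, and potentials
  -- in [-M, M]. The shift by M below makes the base nonnegative, so that it can be multiplied with
  -- the drift.
  let B := R + 1 + 2 * M
  refine ⟨fun s => ∑ i, (s.queue i + (h s + M)) ^ 2, ∑ _i : Fin (n + 2), 2 * B ^ 2, by positivity,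
    fun s => Finset.sum_nonneg fun i _ => sq_nonneg _, fun s hs => ?_⟩
  have hnext : ∀ a y d κ, h (D.next s a y d κ) =
      D.potential p lam (β - α) θ (D.urnsStep s.message (D.decUrns s.recMem) κ) a y := by
    intro a y d κ
    simp only [h, next, D.dec_encUrns]
  rw [D.expect_sum, Finset.mul_sum, ← Finset.sum_sub_distrib, ← Finset.sum_add_distrib]
  refine Finset.sum_le_sum fun i _ => ?_
  have hG : 0 ≤ h s + M := by linarith [neg_le_of_abs_le (hh s)]
  have hpt : ∀ a y d κ, (((D.next s a y d κ).queue i : ℝ) + (h (D.next s a y d κ) + M)) ^ 2 ≤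
      ((s.queue i + (h s + M)) ^ 2 + 2 * B ^ 2) + 2 * (s.queue i + (h s + M)) *
        ((-1 * (d.1 i : ℝ) + (a i).toNat) + (h (D.next s a y d κ) + -h s)) := by
    intro a y d κ
    have ha : (((a i).toNat : ℕ) : ℝ) ≤ 1 := by exact_mod_cast Bool.toNat_le _
    have ha0 : (0 : ℝ) ≤ ((a i).toNat : ℕ) := Nat.cast_nonneg _
    have hd0 : (0 : ℝ) ≤ (d.1 i : ℕ) := Nat.cast_nonneg _
    have hdR := hR d i
    have h1 := abs_le.1 (hh s)
    have h2 := abs_le.1 (hh (D.next s a y d κ))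
    set g := h s
    set g' := h (D.next s a y d κ)
    have hΔ : ((-1 * (d.1 i : ℝ) + (a i).toNat) + (g' + -g)) ^ 2 ≤ B ^ 2 := by
      apply sq_le_sq'
      · simp only [B]; linarith
      · simp only [B]; linarith
    -- If the service exceeds the queue, the increment formula fails, but the new term is then at
    -- most B². As x² + 2xΔ ≥ -Δ² ≥ -B², the slack 2B² suffices.
    rcases le_total (d.1 i) (s.queue i) with hc | hc
    · have hq : ((D.next s a y d κ).queue i : ℝ) = s.queue i - d.1 i + (a i).toNat := by
        simp only [next]
        rw [Nat.cast_add, Nat.cast_sub hc]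
      rw [hq]
      nlinarith [sq_nonneg B]
    · have hq : ((D.next s a y d κ).queue i : ℝ) = (a i).toNat := by
        simp only [next]
        rw [Nat.sub_eq_zero_of_le hc, zero_add]
      have hsq : (((a i).toNat : ℝ) + (g' + M)) ^ 2 ≤ B ^ 2 := by
        apply sq_le_sq'
        · simp only [B]; linarith
        · simp only [B]; linarith
      rw [hq]
      nlinarith [sq_nonneg (((s.queue i : ℝ) + (g + M)) +
        ((-1 * (d.1 i : ℝ) + (a i).toNat) + (g' + -g)))]
  refine (D.expect_mono hA s hpt).trans ?_
  rw [D.expect_add, D.expect_const, D.expect_const_mul, D.expect_add, D.expect_add,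
    D.expect_const_mul, D.expect_schedule s fun d => (d.1 i : ℝ),
    D.expect_arrivals s fun a => ((a i).toNat : ℝ), sum_arrivalWeight_mul, D.expect_add,
    D.expect_const]
  simp_rw [hnext]
  have hpot := D.expect_potential_le hθ hα hβ s hs p hp
  have hr := hrate (D.decUrns s.recMem) i
  -- The θ ∑ dev² terms cancel, and one of the two δ pays for the constant `dueWeight n L θ (n +
  -- 1)`.
  have hneg : (-1 * ∑ d, D.weight (D.decUrns s.recMem).2 d * (d.1 i : ℝ) + lam i) +
      (D.expect C lam s (fun a y _ κ => D.potential p lam (β - α) θ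
        (D.urnsStep s.message (D.decUrns s.recMem) κ) a y) + -h s) ≤ -δ := by
    simp only [h]
    linarith
  have hq : (0 : ℝ) ≤ s.queue i := Nat.cast_nonneg _
  have h3 := mul_le_mul_of_nonneg_left hneg (by linarith : 0 ≤ 2 * (s.queue i + (h s + M)))
  have h4 := mul_nonneg hδ hG
  linarith

/-- The encoder runs one queue ahead: the message held in the state belongs to the urn that is due,
and the next signal concerns the following queue. -/
theorem decPhase_eq_of_mem_stateSpace
    {s : State (n + 2) X Y k v}
    (hs : s ∈ MarkovChain.stateSpace (transition C D.encoder D.allocator lam)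
      (initialStates C D.encoder D.allocator)) :
    D.decPhase s.encMem = (D.decUrns s.recMem).1 + 1 := by
  obtain ⟨s₀, h0, h1⟩ := hs
  induction h1 with
  | refl =>
    obtain ⟨-, -, he, -, hr, -⟩ := h0
    rw [he, hr]
    simp [encoder, allocator, D.dec_encPhase, D.dec_encUrns]
  | tail _ h ih =>
    obtain ⟨a, y, ue, ur, rfl⟩ := exists_nextState_of_transition_ne_zero C _ _ h.ne'
    simp [nextState, encoder, allocator, D.dec_encPhase, D.dec_encUrns, urnsStep, ih]

theorem finite_setOf_sum_queue_le [Finite X] (R : ℕ) :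
    {s : State (n + 2) X Y k v | ∑ i, s.queue i ≤ R}.Finite := by
  let f : State (n + 2) X Y k v →
      (Fin (n + 2) → ℕ) × (Fin (n + 2) → Bool) × Memory k × X × Memory v × Y :=
    fun s => (s.queue, s.arrivals, s.encMem, s.signal, s.recMem, s.message)
  have hf : Function.Injective f := fun s s' h => by
    simp only [f, Prod.mk.injEq] at h
    exact State.ext h.1 h.2.1 h.2.2.1 h.2.2.2.1 h.2.2.2.2.1 h.2.2.2.2.2
  refine (((Set.finite_Iic (fun _ : Fin (n + 2) => R)).prod Set.finite_univ).preimage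
    hf.injOn).subset fun s hs => ⟨fun i => ?_, trivial⟩
  exact (Finset.single_le_sum (f := s.queue) (fun _ _ => Nat.zero_le _) (Finset.mem_univ i)).trans hs

theorem isPositiveRecurrent [Finite X] {α β θ δ : ℝ} (hθ : 0 ≤ θ) (hδ : 0 < δ)
    (hA : IsArrivalRate lam)
    (hα : ∑ y, C.prob D.zero y * (D.isOne y).toNat = α)
    (hβ : ∑ y, C.prob D.one y * (D.isOne y).toNat = β) (p : Fin (n + 2) → ℝ)
    (hp : ∀ j, p j = α + (β - α) * lam j)
    (hrate : ∀ m i, lam i + 2 * δ ≤ ∑ d, D.weight m.2 d * (d.1 i : ℝ) + θ * ∑ j, dev p m j ^ 2)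
    (hw : dueWeight n L θ (n + 1) ≤ δ) (hirr : IsIrreduciblePair C D.encoder D.allocator) :
    MarkovChain.IsPositiveRecurrent (transition C D.encoder D.allocator lam)
      (initialStates C D.encoder D.allocator) := by
  obtain ⟨V, b, hb, hV, hdrift⟩ := D.exists_lyapunov (C := C) hθ hδ.le hA hα hβ p hp hrate hw
  obtain ⟨R, hR⟩ := exists_nat_ge ((b + 1) / (2 * δ))
  refine (hirr lam hA).isPositiveRecurrent (tsum_transition C _ _ hA)
    {s | ∑ i, s.queue i ≤ R} ((finite_setOf_sum_queue_le R).subset Set.inter_subset_left)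
    (fun s => ENNReal.ofReal (V s)) (fun _ => ENNReal.ofReal_ne_top) b.toNNReal ?_ ?_
  · intro s hs hsF
    have h1 := hdrift s (D.decPhase_eq_of_mem_stateSpace hs)
    rw [Set.mem_ofPred_eq, not_le] at hsF
    have h2 : (R : ℝ) ≤ ∑ i, (s.queue i : ℝ) := by exact_mod_cast hsF.le
    rw [div_le_iff₀ (by positivity)] at hR
    have h3 := mul_le_mul_of_nonneg_right h2 (by positivity : 0 ≤ 2 * δ)
    have h4 : 0 ≤ D.expect C lam s (fun a y d κ => V (D.next s a y d κ)) := by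
      rw [← D.expect_const (C := C) (lam := lam) s 0]
      exact D.expect_mono hA s fun _ _ _ _ => hV _
    rw [D.tsum_transition_mul_ofReal hA s V hV, ← ENNReal.ofReal_one, ← ENNReal.ofReal_add h4
      zero_le_one]
    exact ENNReal.ofReal_le_ofReal (by linarith)
  · intro s hs
    have h1 := hdrift s (D.decPhase_eq_of_mem_stateSpace hs)
    have h2 : 0 ≤ 2 * δ * ∑ i, (s.queue i : ℝ) := by positivity
    rw [D.tsum_transition_mul_ofReal hA s V hV]
    change _ ≤ ENNReal.ofReal (V s) + ENNReal.ofReal b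
    rw [← ENNReal.ofReal_add (hV s) hb]
    exact ENNReal.ofReal_le_ofReal (by linarith)

end UrnScheme

end SPII

/-! ### Irreducibility of the urn scheme -/

namespace SPII

namespace UrnScheme

variable {n : ℕ} {Sched : Finset (Fin (n + 2) → ℕ)} {X Y : Type*} {L k v : ℕ}
  (D : UrnScheme Sched X Y L k v) [Fintype Y] {C : Channel X Y} {lam : Fin (n + 2) → ℝ}

/-- Rates may vanish but stay below 1, so steps without arrivals are possible under all rate
vectors; they suffice for irreducibility. -/
theorem transition_next_pos [Countable X] (hA : IsArrivalRate lam) (s : State (n + 2) X Y k v)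
    {y : Y} (hy : 0 < C.prob (D.sig (s.arrivals (D.decPhase s.encMem))) y) (d : Sched)
    (κ : Fin (L + 1)) : 0 < transition C D.encoder D.allocator lam s
      (D.next s (fun _ => false) y d κ) := by
  classical
  set s' := D.next s (fun _ => false) y d κ with hs'
  have h1 := D.tsum_transition_mul (C := C) hA s fun x => if x = s' then 1 else 0
  rw [tsum_eq_single s' fun x hx => by simp [hx], if_pos rfl, mul_one] at h1
  have hpos : 0 < D.stepWeight C lam s (fun _ => false) y d := by
    unfold stepWeight arrivalWeight
    refine mul_pos (mul_pos (mul_pos (Finset.prod_pos fun i _ => ?_) hy) (D.weight_pos _ _))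
      (by positivity)
    simpa using (hA i).2
  rw [h1]
  refine lt_of_lt_of_le (ENNReal.ofReal_pos.2 hpos) ?_
  calc ENNReal.ofReal (D.stepWeight C lam s (fun _ => false) y d)
      = ENNReal.ofReal (D.stepWeight C lam s (fun _ => false) y d) *
        (if D.next s (fun _ => false) y d κ = s' then 1 else 0) := by simp [hs']
    _ ≤ _ := (Finset.single_le_sum (f := fun κ => ENNReal.ofReal
        (D.stepWeight C lam s (fun _ => false) y d) *
        (if D.next s (fun _ => false) y d κ = s' then 1 else 0)) (fun _ _ => zero_le)
        (Finset.mem_univ κ))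
    _ ≤ _ := (Finset.single_le_sum (f := fun d => ∑ κ, ENNReal.ofReal
        (D.stepWeight C lam s (fun _ => false) y d) *
        (if D.next s (fun _ => false) y d κ = s' then 1 else 0)) (fun _ _ => zero_le)
        (Finset.mem_univ d))
    _ ≤ _ := (Finset.single_le_sum (f := fun y => ∑ d, ∑ κ, ENNReal.ofReal
        (D.stepWeight C lam s (fun _ => false) y d) *
        (if D.next s (fun _ => false) y d κ = s' then 1 else 0)) (fun _ _ => zero_le)
        (Finset.mem_univ y))
    _ ≤ _ := (Finset.single_le_sum (f := fun a => ∑ y, ∑ d, ∑ κ, ENNReal.ofReal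
        (D.stepWeight C lam s a y d) *
        (if D.next s a y d κ = s' then 1 else 0)) (fun _ _ => zero_le)
        (Finset.mem_univ fun _ => false))

/-- The state with queues `q` and urns `z`, of which `r` is due, after a period of no arrivals. -/
def idleState (y₀ : Y) (q : Fin (n + 2) → ℕ) (r : Fin (n + 2)) (z : Fin (n + 2) → Fin (L + 2)) :
    State (n + 2) X Y k v :=
  ⟨q, fun _ => false, D.encPhase (r + 1), D.zero, D.encUrns (r, z), y₀⟩

/-- Ball 0 is marked whenever any ball is, so drawing it on a negative message unmarks one, while
the schedule c e_r serves the queue that is due. -/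
theorem exists_leads_idleState_succ [Countable X] (hA : IsArrivalRate lam) {y₀ : Y}
    (h0 : D.isOne y₀ = false) (hy : 0 < C.prob D.zero y₀) {c : ℕ} (hc : 0 < c)
    (hcS : ∀ i, Pi.single i c ∈ Sched) (q : Fin (n + 2) → ℕ) (r : Fin (n + 2))
    (z : Fin (n + 2) → Fin (L + 2)) :
    ∃ q' z', q' ≤ q ∧ z' ≤ z ∧ (q' r + (z' r).val < q r + (z r).val ∨ q r + (z r).val = 0) ∧
      MarkovChain.Leads (transition C D.encoder D.allocator lam) (D.idleState y₀ q r z)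
        (D.idleState y₀ q' (r + 1) z') := by
  refine ⟨fun i => q i - (Pi.single r c : Fin (n + 2) → ℕ) i,
    Function.update z r (urnStep false (z r) 0), fun i => Nat.sub_le _ _, ?_, ?_, ?_⟩
  · rw [update_le_iff]
    refine ⟨?_, fun _ _ => le_rfl⟩
    simp only [urnStep, Bool.false_eq_true, if_false]
    split_ifs
    · exact Fin.le_def.2 (Nat.sub_le _ _)
    · exact le_rfl
  · simp only [Pi.single_eq_same, Function.update_self, urnStep, Bool.false_eq_true, if_false]
    split_ifs with h
    · simp only [Fin.val_zero] at h ⊢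
      omega
    · simp only [Fin.val_zero] at h
      omega
  · refine Relation.ReflTransGen.single ?_
    have := D.transition_next_pos (C := C) hA (D.idleState y₀ q r z) (y := y₀)
      (by simpa [idleState, sig] using hy) ⟨Pi.single r c, hcS r⟩ 0
    convert this using 1
    simp [idleState, next, D.dec_encPhase, D.dec_encUrns, urnsStep, h0, sig]

theorem exists_leads_idleState [Countable X] (hA : IsArrivalRate lam) {y₀ : Y}
    (h0 : D.isOne y₀ = false) (hy : 0 < C.prob D.zero y₀) {c : ℕ} (hc : 0 < c)
    (hcS : ∀ i, Pi.single i c ∈ Sched) (r' : Fin (n + 2)) (q : Fin (n + 2) → ℕ) (r : Fin (n + 2))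
    (z : Fin (n + 2) → Fin (L + 2)) :
    ∃ q' z', q' ≤ q ∧ z' ≤ z ∧
      MarkovChain.Leads (transition C D.encoder D.allocator lam) (D.idleState y₀ q r z)
        (D.idleState y₀ q' r' z') := by
  obtain ⟨m, hm⟩ : ∃ m, (r' - r).val = m := ⟨_, rfl⟩
  induction m generalizing q r z with
  | zero =>
    have : r' = r := sub_eq_zero.1 (Fin.ext hm)
    subst this
    exact ⟨q, z, le_rfl, le_rfl, .refl⟩
  | succ m ih =>
    obtain ⟨q₁, z₁, hq, hz, -, h⟩ := D.exists_leads_idleState_succ hA h0 hy hc hcS q r z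
    have h1 : r' - (r + 1) = (r' - r) - 1 := by abel
    have hne : r' - r ≠ 0 := fun h => by simp [h] at hm
    obtain ⟨q₂, z₂, hq2, hz2, h2⟩ := ih q₁ (r + 1) z₁ (by
      rw [h1, Fin.coe_sub_one, if_neg hne, hm, Nat.add_sub_cancel])
    exact ⟨q₂, z₂, hq2.trans hq, hz2.trans hz, h.trans h2⟩

theorem exists_leads_idleState_zero [Countable X] (hA : IsArrivalRate lam) {y₀ : Y}
    (h0 : D.isOne y₀ = false) (hy : 0 < C.prob D.zero y₀) {c : ℕ} (hc : 0 < c)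
    (hcS : ∀ i, Pi.single i c ∈ Sched) (q : Fin (n + 2) → ℕ) (r : Fin (n + 2))
    (z : Fin (n + 2) → Fin (L + 2)) :
    ∃ r', MarkovChain.Leads (transition C D.encoder D.allocator lam) (D.idleState y₀ q r z)
        (D.idleState y₀ 0 r' 0) := by
  obtain ⟨T, hT⟩ : ∃ T, ∑ j, (q j + (z j).val) = T := ⟨_, rfl⟩
  induction T using Nat.strong_induction_on generalizing q r z with
  | _ T ih =>
    by_cases hzero : ∀ j, q j + (z j).val = 0
    · have hq : q = 0 := funext fun j => (Nat.add_eq_zero_iff.1 (hzero j)).1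
      have hz : z = 0 := funext fun j => Fin.ext (Nat.add_eq_zero_iff.1 (hzero j)).2
      subst hq hz
      exact ⟨r, .refl⟩
    push Not at hzero
    obtain ⟨j, hj⟩ := hzero
    obtain ⟨q₁, z₁, hq1, hz1, h1⟩ := D.exists_leads_idleState hA h0 hy hc hcS j q r z
    obtain ⟨q₂, z₂, hq2, hz2, hlt, h2⟩ := D.exists_leads_idleState_succ hA h0 hy hc hcS q₁ j z₁
    have hsum : ∑ i, (q₂ i + (z₂ i).val) < T := by
      rw [← hT]
      refine Finset.sum_lt_sum (fun i _ => add_le_add ((hq2 i).trans (hq1 i))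
        (Fin.le_def.1 ((hz2 i).trans (hz1 i)))) ⟨j, Finset.mem_univ j, ?_⟩
      have a1 : q₁ j ≤ q j := hq1 j
      have a2 := Fin.le_def.1 (hz1 j)
      have a3 : q₂ j ≤ q₁ j := hq2 j
      have a4 := Fin.le_def.1 (hz2 j)
      omega
    obtain ⟨r', h3⟩ := ih _ hsum q₂ (j + 1) z₂ rfl
    exact ⟨r', (h1.trans h2).trans h3⟩

/-- It suffices to reach every initial state. Two steps without arrivals make the state idle, after
which queues and urns can be emptied. The phase is then brought to -1, so that one more step, with
the message of `t₀`, ends in `t₀`. -/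
theorem isIrreduciblePair [Countable X] {y₀ : Y} (h0 : D.isOne y₀ = false)
    (hy : 0 < C.prob D.zero y₀) (hS : ∃ c : ℕ, 0 < c ∧ ∀ i, Pi.single i c ∈ Sched) :
    IsIrreduciblePair C D.encoder D.allocator := by
  obtain ⟨c, hc, hcS⟩ := hS
  intro lam hA s hs t ht
  obtain ⟨t₀, ht₀, htt⟩ := ht
  refine Relation.ReflTransGen.trans ?_ htt
  have hphase := D.decPhase_eq_of_mem_stateSpace hs
  obtain ⟨y, hy1⟩ : ∃ y, 0 < C.prob (D.sig (s.arrivals (D.decPhase s.encMem))) y := by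
    by_contra! h
    have := C.sum_eq_one (D.sig (s.arrivals (D.decPhase s.encMem)))
    linarith [Finset.sum_nonpos fun y (_ : y ∈ Finset.univ) => h y]
  let d : Sched := ⟨Pi.single 0 c, hcS 0⟩
  have h1 := D.transition_next_pos (C := C) hA s hy1 d 0
  have h2 := D.transition_next_pos (C := C) hA (D.next s (fun _ => false) y d 0) (y := y₀)
    (by simpa [next, sig] using hy) d 0
  set s₂ := D.next (D.next s (fun _ => false) y d 0) (fun _ => false) y₀ d 0 with hs₂
  obtain ⟨q, r, z, hqrz⟩ : ∃ q r z, s₂ = D.idleState y₀ q r z := by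
    refine ⟨s₂.queue, (D.decUrns s.recMem).1 + 1 + 1, (D.decUrns s₂.recMem).2, ?_⟩
    simp [hs₂, idleState, next, D.dec_encPhase, D.dec_encUrns, urnsStep, sig, hphase]
  obtain ⟨r', h3⟩ := D.exists_leads_idleState_zero hA h0 hy hc hcS q r z
  obtain ⟨q', z', hq', hz', h4⟩ := D.exists_leads_idleState hA h0 hy hc hcS (-1) 0 r' 0
  obtain rfl : q' = 0 := le_antisymm hq' zero_le
  obtain rfl : z' = 0 := le_antisymm hz' fun i => Fin.zero_le _
  obtain ⟨b1, b2, b3, b4, b5, b6⟩ := ht₀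
  rw [b4] at b6
  have h5 := D.transition_next_pos (C := C) hA (D.idleState y₀ 0 (-1) 0) (y := t₀.message)
    (by simpa [idleState, sig, encoder] using b6) d 0
  have h6 : D.next (D.idleState y₀ 0 (-1) 0) (fun _ => false) t₀.message d 0 = t₀ := by
    refine State.ext ?_ ?_ ?_ ?_ ?_ rfl
    · rw [b1]
      funext i
      simp [next, idleState]
    · rw [b2]
      rfl
    · rw [b3]
      simp [next, idleState, encoder, D.dec_encPhase]
    · rw [b4]
      simp [next, idleState, encoder, sig]
    · rw [b5]
      simp [next, idleState, allocator, D.dec_encUrns, urnsStep, h0, urnStep]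
  rw [h6] at h5
  rw [hqrz] at h2
  have l1 : MarkovChain.Leads (transition C D.encoder D.allocator lam) s _ := .single h1
  exact (((l1.tail h2).trans h3).trans h4).tail h5

end UrnScheme

end SPII

/-! ### The capacity factor -/

namespace SPII

/-- Used in both directions: one letter makes β > α strict, the other is a negative message that is
possible under the signal `zero`. -/
theorem exists_lt_of_sum_eq {Y : Type*} [Fintype Y] {f g : Y → ℝ} (hne : f ≠ g)
    (hsum : ∑ y, f y = ∑ y, g y) : ∃ y, f y < g y := by
  by_contra! h
  refine hne (funext fun y => ?_)
  exact ((Finset.sum_eq_sum_iff_of_le fun y _ => h y).1 hsum.symm y (Finset.mem_univ y)).symm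

theorem exists_weights_of_mem_scheduleHull {N : ℕ} {Sched : Finset (Fin N → ℕ)} {y : Fin N → ℝ}
    (hy : y ∈ scheduleHull Sched) : ∃ q : Sched → ℝ, (∀ d, 0 ≤ q d) ∧ ∑ d, q d = 1 ∧
      ∀ i, y i = ∑ d, q d * (d.1 i : ℝ) := by
  classical
  refine (convexHull_min (t := {y : Fin N → ℝ | ∃ q : Sched → ℝ, (∀ d, 0 ≤ q d) ∧ ∑ d, q d = 1 ∧
    ∀ i, y i = ∑ d, q d * (d.1 i : ℝ)}) ?_ ?_) hy
  · rintro _ ⟨d, hd, rfl⟩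
    refine ⟨Pi.single ⟨d, hd⟩ 1, fun d' => ?_, by simp, fun i => ?_⟩
    · rw [Pi.single_apply]
      split_ifs <;> norm_num
    · rw [Finset.sum_eq_single ⟨d, hd⟩]
      · simp
      · intro d' _ h
        simp [h]
      · simp
  · rintro x ⟨p, hp0, hp1, hp⟩ z ⟨q, hq0, hq1, hq⟩ a b ha hb hab
    refine ⟨fun d => a * p d + b * q d, fun d => add_nonneg (mul_nonneg ha (hp0 d))
      (mul_nonneg hb (hq0 d)), ?_, fun i => ?_⟩
    · rw [Finset.sum_add_distrib, ← Finset.mul_sum, ← Finset.mul_sum, hp1, hq1, mul_one, mul_one,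
        hab]
    · simp only [Pi.add_apply, Pi.smul_apply, smul_eq_mul, hp, hq, add_mul,
        Finset.sum_add_distrib, Finset.mul_sum, mul_assoc]

theorem IsScheduleSet.card_pos {N : ℕ} {Sched : Finset (Fin N → ℕ)} (hS : IsScheduleSet Sched) :
    0 < Sched.card := by
  obtain ⟨d, _, _, hd, _⟩ := hS.two_maximal
  exact Finset.card_pos.2 ⟨d, hd.1⟩

/-- Rates in `ρ Λ` with `ρ < 1` are exceeded by the mean of a distribution on the schedules that
charges all of them, with a margin that depends on `ρ` only. -/
theorem exists_pos_weights {N : ℕ} {Sched : Finset (Fin N → ℕ)} (hS : IsScheduleSet Sched)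
    {ρ : ℝ≥0} (hρ : ρ < 1) {lam : Fin N → ℝ} (h : lam ∈ (ρ : ℝ) • maxCapacityRegion Sched) :
    ∃ p : Sched → ℝ, (∀ d, 0 < p d) ∧ ∑ d, p d = 1 ∧
      ∀ i, lam i + (1 - ρ) / Sched.card ≤ ∑ d, p d * (d.1 i : ℝ) := by
  obtain ⟨l, ⟨-, y, hy, hly⟩, rfl⟩ := h
  obtain ⟨q, hq0, hq1, hq⟩ := exists_weights_of_mem_scheduleHull hy
  have hcard : (0 : ℝ) < Sched.card := by exact_mod_cast hS.card_pos
  have hρ' : (ρ : ℝ) < 1 := by exact_mod_cast hρ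
  have hε : 0 < (1 - ρ : ℝ) / Sched.card := div_pos (by linarith) hcard
  refine ⟨fun d => ρ * q d + (1 - ρ) / Sched.card, fun d => ?_, ?_, fun i => ?_⟩
  · have := mul_nonneg ρ.coe_nonneg (hq0 d)
    linarith
  · rw [Finset.sum_add_distrib, ← Finset.mul_sum, hq1, Finset.sum_const, Finset.card_univ,
      Fintype.card_coe, nsmul_eq_mul]
    field_simp
    ring
  · simp only [Pi.smul_apply, smul_eq_mul, add_mul, Finset.sum_add_distrib, mul_assoc,
      ← Finset.mul_sum, ← hq]
    refine add_le_add (mul_le_mul_of_nonneg_left (hly i).le ρ.coe_nonneg) ?_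
    obtain ⟨c, hc, hcS⟩ := hS.nondegenerate
    have h1 : (1 : ℝ) ≤ ∑ d : Sched, (d.1 i : ℝ) := by
      refine le_trans ?_ (Finset.single_le_sum (f := fun d : Sched => (d.1 i : ℝ))
        (fun _ _ => Nat.cast_nonneg _) (Finset.mem_univ ⟨Pi.single i c, hcS i⟩))
      simp only [Pi.single_eq_same]
      exact_mod_cast hc
    exact le_mul_of_one_le_right hε.le h1

theorem le_capacityFactor {n : ℕ} {Sched : Finset (Fin (n + 2) → ℕ)} (hS : IsScheduleSet Sched)
    {X Y : Type*} [Finite X] [Fintype Y] (C : Channel X Y) (hC : C.IsInformative) {ρ : ℝ≥0}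
    (hρ : ρ < 1) {k : ℕ} (hk : n + 2 ≤ 2 ^ k) :
    ∀ᶠ v in atTop, (ρ : ℝ≥0∞) ≤ capacityFactor Sched C k v := by
  classical
  obtain ⟨x₀, x₁, hx⟩ := hC
  have hsum : ∑ y, C.prob x₀ y = ∑ y, C.prob x₁ y := by rw [C.sum_eq_one, C.sum_eq_one]
  obtain ⟨y₁, hy₁⟩ := exists_lt_of_sum_eq hx hsum
  obtain ⟨y₀, hy₀⟩ := exists_lt_of_sum_eq hx.symm hsum.symm
  let isOne : Y → Bool := fun y => decide (C.prob x₀ y < C.prob x₁ y)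
  obtain ⟨α, hα⟩ : ∃ α, ∑ y, C.prob x₀ y * (isOne y).toNat = α := ⟨_, rfl⟩
  obtain ⟨β, hβ⟩ : ∃ β, ∑ y, C.prob x₁ y * (isOne y).toNat = β := ⟨_, rfl⟩
  have hαβ : 0 < β - α := by
    rw [sub_pos, ← hα, ← hβ]
    refine Finset.sum_lt_sum (fun y _ => ?_) ⟨y₁, Finset.mem_univ _, ?_⟩
    · by_cases h : C.prob x₀ y < C.prob x₁ y
      · simp [isOne, h, h.le]
      · simp [isOne, h]
    · simp [isOne, hy₁]
  have hcard : (1 : ℝ) ≤ Sched.card := by exact_mod_cast hS.card_pos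
  have hρ' : (ρ : ℝ) < 1 := by exact_mod_cast hρ
  obtain ⟨ε, hε⟩ : ∃ ε : ℝ, (1 - ρ) / Sched.card = ε := ⟨_, rfl⟩
  have hε0 : 0 < ε := hε ▸ div_pos (by linarith) (by linarith)
  have hε1 : ε ≤ 1 := by
    rw [← hε, div_le_one (by linarith)]
    linarith [ρ.coe_nonneg]
  -- An urn deviation of η(L+1) shifts the estimated rate by ε/4.
  obtain ⟨η, hη⟩ : ∃ η, η = (β - α) * (ε / 4) := ⟨_, rfl⟩
  have hη0 : 0 < η := by rw [hη]; positivity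
  -- The noise `dueWeight n L θ (n + 1)` is at most 3(n+2)/(η²(L+1)) and must not exceed δ = ε/8.
  -- The choice does not involve the rates.
  obtain ⟨L, hL⟩ := exists_nat_ge (24 * (n + 2) / (η ^ 2 * ε))
  have hL0 : (0 : ℝ) < L + 1 := by positivity
  -- One urn off by more than η(L+1) makes θ ∑ dev² at least 2, which exceeds λ_i + ε/4.
  let θ : ℝ := 2 / (η * (L + 1)) ^ 2
  have hθ0 : 0 ≤ θ := by positivity
  -- The weights may depend on the urns only. When all estimates are within ε/4, the distribution
  -- with margin ε over the true rates is good, so a good one exists; the choice made exceeds the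
  -- true rates by ε/2 - ε/4 = 2δ.
  let Good : (Fin (n + 2) → Fin (L + 2)) → (Sched → ℝ) → Prop := fun z p =>
    (∀ d, 0 < p d) ∧ ∑ d, p d = 1 ∧
      ∀ i, ((z i).val / (L + 1) - α) / (β - α) + ε / 2 ≤ ∑ d, p d * (d.1 i : ℝ)
  obtain ⟨w, hw0, hw1, hw⟩ : ∃ w : (Fin (n + 2) → Fin (L + 2)) → Sched → ℝ,
      (∀ z d, 0 < w z d) ∧ (∀ z, ∑ d, w z d = 1) ∧ ∀ z, (∃ p, Good z p) → Good z (w z) := by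
    have h : ∀ z, ∃ p : Sched → ℝ, (∀ d, 0 < p d) ∧ ∑ d, p d = 1 ∧ ((∃ p, Good z p) → Good z p) := by
      intro z
      by_cases h : ∃ p, Good z p
      · obtain ⟨p, hp⟩ := h
        exact ⟨p, hp.1, hp.2.1, fun _ => hp⟩
      · refine ⟨fun _ => 1 / Sched.card, fun _ => by positivity, ?_, fun h' => absurd h' h⟩
        rw [Finset.sum_const, Finset.card_univ, Fintype.card_coe, nsmul_eq_mul]
        field_simp
    choose w h1 h2 h3 using h
    exact ⟨w, h1, h2, h3⟩
  filter_upwards [eventually_ge_atTop ((n + 2) * (L + 2) ^ (n + 2))] with v hv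
  obtain ⟨D, rfl, rfl, hD1, rfl⟩ := exists_urnScheme (Sched := Sched) (L := L) (k := k) (v := v)
    x₀ x₁ isOne w hw0 hw1 hk (Nat.lt_two_pow_self.le.trans (Nat.pow_le_pow_right (by norm_num) hv))
  rw [← hD1] at hα hβ
  have hirr : IsIrreduciblePair C D.encoder D.allocator :=
    D.isIrreduciblePair (y₀ := y₀) (by simp [hD1, isOne, hy₀.le])
      ((C.nonneg _ _).trans_lt hy₀) hS.nondegenerate
  refine le_iSup_of_le D.encoder (le_iSup_of_le D.allocator (le_iSup_of_le hirr
    (le_iSup₂_of_le ρ (fun lam hlam hA => ⟨hA, ?_⟩) le_rfl)))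
  obtain ⟨p, hp0, hp1, hp⟩ := exists_pos_weights hS hρ hlam
  rw [hε] at hp
  refine D.isPositiveRecurrent hθ0 (by positivity : 0 < ε / 8) hA hα hβ
    (fun j => α + (β - α) * lam j) (fun j => rfl) (fun m i => ?_) ?_ hirr
  · by_cases hdev : ∀ j, |UrnScheme.dev (fun j => α + (β - α) * lam j) m j| ≤ η * (L + 1)
    · have hest : ∀ j, ((m.2 j).val / (L + 1) - α) / (β - α) = lam j +
          UrnScheme.dev (fun j => α + (β - α) * lam j) m j / ((L + 1) * (β - α)) := by
        intro j
        simp only [UrnScheme.dev]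
        field_simp
        ring
      have hsmall : ∀ j,
          |UrnScheme.dev (fun j => α + (β - α) * lam j) m j / ((L + 1) * (β - α))| ≤ ε / 4 := by
        intro j
        rw [abs_div, abs_of_pos (mul_pos hL0 hαβ), div_le_iff₀ (mul_pos hL0 hαβ)]
        refine (hdev j).trans (le_of_eq ?_)
        rw [hη]
        ring
      have hgood : Good m.2 p := by
        refine ⟨hp0, hp1, fun j => ?_⟩
        rw [hest]
        linarith [hp j, le_of_abs_le (hsmall j)]
      have h1 := (hw m.2 ⟨p, hgood⟩).2.2 i
      rw [hest] at h1
      have h2 : 0 ≤ θ * ∑ j, UrnScheme.dev (fun j => α + (β - α) * lam j) m j ^ 2 := by positivity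
      linarith [neg_le_of_abs_le (hsmall i)]
    · push Not at hdev
      obtain ⟨j, hj⟩ := hdev
      have h1 : 2 ≤ θ * ∑ j, UrnScheme.dev (fun j => α + (β - α) * lam j) m j ^ 2 := by
        have h2 : (η * (L + 1)) ^ 2 ≤ ∑ j, UrnScheme.dev (fun j => α + (β - α) * lam j) m j ^ 2 := by
          refine le_trans ?_ (Finset.single_le_sum
            (f := fun j => UrnScheme.dev (fun j => α + (β - α) * lam j) m j ^ 2)
            (fun _ _ => sq_nonneg _) (Finset.mem_univ j))
          rw [← sq_abs (UrnScheme.dev _ m j)]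
          exact pow_le_pow_left₀ (by positivity) hj.le 2
        calc (2 : ℝ) = θ * (η * (L + 1)) ^ 2 := by
              simp only [θ]
              field_simp
          _ ≤ _ := mul_le_mul_of_nonneg_left h2 hθ0
      have h3 : 0 ≤ ∑ d, D.weight m.2 d * (d.1 i : ℝ) :=
        Finset.sum_nonneg fun d _ => mul_nonneg (hw0 m.2 d).le (Nat.cast_nonneg _)
      linarith [(hA i).2]
  · have hn : (0 : ℝ) ≤ n := Nat.cast_nonneg _
    have hLn : (0 : ℝ) ≤ L := Nat.cast_nonneg _
    rw [div_le_iff₀ (by positivity)] at hL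
    have h1 : UrnScheme.dueWeight n L θ (n + 1) ≤ θ * (3 / 2 * (n + 2) * (L + 1)) := by
      unfold UrnScheme.dueWeight
      refine mul_le_mul_of_nonneg_left ?_ hθ0
      nlinarith
    refine h1.trans ?_
    have h2 : θ * (3 / 2 * (n + 2) * (L + 1)) = 3 * (n + 2) / (η ^ 2 * (L + 1)) := by
      simp only [θ]
      field_simp
    rw [h2, div_le_iff₀ (by positivity)]
    nlinarith [mul_pos (pow_pos hη0 2) hε0]

end SPII

theorem mainTheorem6 {N : ℕ} (Sched : Finset (Fin N → ℕ)) (hSched : SPII.IsScheduleSet Sched)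
    {X Y : Type*} [Fintype X] [Fintype Y] (C : SPII.Channel X Y) (hC : C.IsInformative) :
    Tendsto (fun v : ℕ => min (SPII.capacityFactor Sched C (Nat.clog 2 N) v) 1) atTop (𝓝 1) ∧
    ((fun _ => (1 : ℝ)) ∉ SPII.scheduleHull Sched →
      Tendsto (fun v : ℕ => SPII.capacityFactor Sched C (Nat.clog 2 N) v) atTop (𝓝 1)) := by
  obtain ⟨n, rfl⟩ := Nat.exists_eq_add_of_le' hSched.two_le
  have hlow : ∀ a : ℝ≥0∞, a < 1 →
      ∀ᶠ v in atTop, a < SPII.capacityFactor Sched C (Nat.clog 2 (n + 2)) v := by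
    intro a ha
    obtain ⟨ρ, haρ, hρ⟩ := ENNReal.lt_iff_exists_nnreal_btwn.1 ha
    filter_upwards [SPII.le_capacityFactor hSched C hC (by exact_mod_cast hρ)
      (Nat.le_pow_clog (by norm_num) (n + 2))] with v hv
    exact haρ.trans_le hv
  refine ⟨tendsto_order.2 ⟨fun a ha => ?_, fun a ha => ?_⟩, fun h1 =>
    tendsto_order.2 ⟨hlow, fun a ha => ?_⟩⟩
  · filter_upwards [hlow a ha] with v hv
    exact lt_min hv ha
  · exact Eventually.of_forall fun v => (min_le_right _ _).trans_lt ha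
  · refine Eventually.of_forall fun v => lt_of_le_of_lt ?_ ha
    exact iSup_le fun φ => iSup_le fun ψ => iSup_le fun _ =>
      SPII.pairCapacityFactor_le_one hSched h1 C φ ψ
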